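/- Let $\mathcal O$ be a Dedekind domain, $\pi\in\mathcal O$ a generator of a non-zero prime ideal with finite residue field, and let $q$ be the cardinality of $\mathcal O/(\pi)$. Put $C_\pi(X,Y)=\frac{X^q+Y^q-(X+Y)^q}{\pi}\in\mathcal O[X,Y]$. For a morphism of $\mathcal O$-algebras $u\colon A\to B$, a $\pi$-derivation relative to $u$ is a map $\delta\colon A\to B$ with $\delta(x+y)=\delta x+\delta y+C_\pi(u(x),u(y))$ and $\delta(xy)=u(x)^q\delta y+u(y)^q\delta x+\pi\,\delta x\,\delta y$. Let $R_*=(R_n,u_n,\delta_n)_{n\ge 0}$ be a prolongation sequence over $\mathcal O_*$: the $R_n$ are $\mathcal O$-algebras, $u_n\colon R_n\to R_{n+1}$ are morphisms of $\mathcal O$-algebras, $\delta_n\colon R_n\to R_{n+1}$ are $\pi$-derivations relative to $u_n$, $u_{n+1}\circ\delta_n=\delta_{n+1}\circ u_n$, and $\delta_n$ is compatible with the $\pi$-derivation $c\mapsto\pi^{-1}(c-c^q)$ of $\mathcal O$. Morphisms of prolongation sequences are families of $\mathcal O$-algebra morphisms commuting with the $u_n$ and $\delta_n$. Fix $n\ge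 0$. For an $\mathcal O$-algebra $B$ let $W_n(B)=B^{n+1}$ be the ring of truncated $\pi$-typical Witt vectors, i.e. the $\mathcal O$-algebra structure functorial in $B$ for which the ghost polynomials $w_i=x_0^{q^i}+\pi x_1^{q^{i-1}}+\dots+\pi^i x_i$ $(0\le i\le n)$ are morphisms of $\mathcal O$-algebras. Let $P_k\in\mathcal O[T,T',\dots,T^{(k)}]$ be the polynomials with $w_i(P_0,\dots,P_i)=\phi^i(T)$ for all $i\ge 0$, where $\phi$ is the $\mathcal O$-algebra endomorphism $T^{(j)}\mapsto (T^{(j)})^q+\pi T^{(j+1)}$. If $B$ is an $R_n$-algebra, $W_n(B)$ is an $R_0$-algebra through $R_0\to W_n(R_n)\to W_n(B)$, where the first map is $c\mapsto(P_0(c),\dots,P_n(c))$ with $P_k(c)=P_k(c,\delta c,\dots,\delta^k c)$, taken in $R_n$. For a scheme $X$ over $R_0$ let $J^nX$ be Borger's jet functor on affine $R_n$-schemes, $(J^nX)(B)=X(W_n(B))=\operatorname{Hom}_{R_0}(\operatorname{Spec}W_n(B),X)$ for every $R_n$-algebra $B$. For an $R_0$-algebra $A$ with a presentation $A=R_0[\mathbf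 x]/(\mathbf f)$, with arbitrary families of variables $\mathbf x=(x_\gamma)$ and of polynomials $\mathbf f=(f_j)$, let $$J_nA=R_n[\mathbf x,\mathbf x^{(1)},\dots,\mathbf x^{(n)}]/(\mathbf f,\delta\mathbf f,\dots,\delta^n\mathbf f)$$ be Buium's $\pi$-jet algebra, where the rings $R_m[\mathbf x,\dots,\mathbf x^{(m)}]$ form a prolongation sequence extending $R_*$ with $u_m(x_\gamma^{(i)})=x_\gamma^{(i)}$ and $\delta_m(x_\gamma^{(i)})=x_\gamma^{(i+1)}$. A morphism $g\colon A\to A'$ of $R_0$-algebras (with presentations) induces the morphism of $R_n$-algebras $J_nA\to J_nA'$, $x_\gamma^{(i)}\mapsto\delta^i(g(x_\gamma))$. For $X=\operatorname{Spec}A$ affine over $R_0$ put $J^n_{\mathrm{Bu}}X=\operatorname{Spec}J_nA$. Then for every affine scheme $X=\operatorname{Spec}A$ over $R_0$ the functor $J^nX$ is a sheaf of sets on the category of affine schemes over $R_n$ with the étale topology, and for every presentation of $A$ there is an isomorphism of sheaves $$J^nX\simeq J^n_{\mathrm{Bu}}X ,$$ natural in $X$: for every morphism $X\to Y$ of affine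 $R_0$-schemes, and all presentations of their rings of functions, the isomorphisms commute with the induced morphisms $J^nX\to J^nY$ and $J^n_{\mathrm{Bu}}X\to J^n_{\mathrm{Bu}}Y$. In particular $J^nX$ is representable by an affine $R_n$-scheme. -/

import Mathlib

universe v w u t

set_option linter.unusedSectionVars false
set_option linter.unusedVariables false

namespace PiJet

section Witt

variable {O : Type v} [CommRing O] (π : O)

/-- The cardinality `q` of the residue ring `O / (π)`. -/
noncomputable def q : ℕ := Nat.card (O ⧸ Ideal.span {π})

/-- The `i`-th Witt (ghost) polynomial
`w_i = x_0 ^ (q ^ i) + π x_1 ^ (q ^ (i - 1)) + ⋯ + π ^ i x_i`, evaluated at a sequence. -/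
noncomputable def wittPoly {B : Type w} [CommRing B] [Algebra O B] (x : ℕ → B) (i : ℕ) : B :=
  ∑ j ∈ Finset.range (i + 1), algebraMap O B (π ^ j) * x j ^ q π ^ (i - j)

section Lemmas

variable {A : Type w} [CommRing A] [Algebra O A]

lemma wittPoly_congr {x y : ℕ → A} {i : ℕ} (h : ∀ j ≤ i, x j = y j) :
    wittPoly π x i = wittPoly π y i := by
  refine Finset.sum_congr rfl fun j hj => ?_
  rw [h j (Nat.lt_succ_iff.mp (Finset.mem_range.mp hj))]

lemma map_wittPoly {B : Type u} [CommRing B] [Algebra O B] (f : A →ₐ[O] B) (x : ℕ → A) (i : ℕ) :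
    f (wittPoly π x i) = wittPoly π (fun j => f (x j)) i := by
  simp [wittPoly, map_sum]

lemma wittPoly_succ_eq (x : ℕ → A) (i : ℕ) :
    wittPoly π x i = ∑ j ∈ Finset.range i, algebraMap O A (π ^ j) * x j ^ q π ^ (i - j)
      + algebraMap O A (π ^ i) * x i := by
  simp [wittPoly, Finset.sum_range_succ]

variable {π} in
lemma eq_of_wittPoly_eq (hA : ∀ a : A, algebraMap O A π * a = 0 → a = 0) {x y : ℕ → A} {n : ℕ}
    (h : ∀ i ≤ n, wittPoly π x i = wittPoly π y i) : ∀ i ≤ n, x i = y i := by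
  have hA' : ∀ k (a : A), algebraMap O A π ^ k * a = 0 → a = 0 := by
    intro k
    induction k with
    | zero => simp
    | succ k ih => intro a ha; rw [pow_succ', mul_assoc] at ha; exact ih a (hA _ ha)
  intro i
  induction i using Nat.strong_induction_on with
  | _ i ih =>
    intro hi
    have h1 := h i hi
    rw [wittPoly_succ_eq, wittPoly_succ_eq, Finset.sum_congr rfl
      (g := fun j => algebraMap O A (π ^ j) * y j ^ q π ^ (i - j))] at h1
    · have h2 := add_left_cancel h1
      rw [map_pow, ← sub_eq_zero, ← mul_sub] at h2
      exact sub_eq_zero.1 (hA' _ _ h2)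
    · intro j hj
      have := Finset.mem_range.mp hj
      rw [ih j this (by omega)]

variable [hπ : Fact (Prime π)] [Finite (O ⧸ Ideal.span {π})]

lemma exists_prime_pow : ∃ p h : ℕ, p.Prime ∧ q π = p ^ h ∧ π ∣ (p : O) ∧ h ≠ 0 := by
  have hp := hπ.out
  have : (Ideal.span {π}).IsPrime := (Ideal.span_singleton_prime hp.ne_zero).2 hp
  let _ : Field (O ⧸ Ideal.span {π}) := Finite.isField_of_domain _ |>.toField
  let _ := Fintype.ofFinite (O ⧸ Ideal.span {π})
  obtain ⟨p, hc⟩ := CharP.exists (O ⧸ Ideal.span {π})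
  obtain ⟨n, hp', hn⟩ := FiniteField.card (O ⧸ Ideal.span {π}) p
  refine ⟨p, n, hp', ?_, ?_, n.ne_zero⟩
  · rw [q, Nat.card_eq_fintype_card, hn]
  · rw [← Ideal.mem_span_singleton, ← Ideal.Quotient.eq_zero_iff_mem, map_natCast]
    exact CharP.cast_eq_zero _ p

lemma dvd_sub_pow_q (c : O) : π ∣ c - c ^ q π := by
  have hp := hπ.out
  have : (Ideal.span {π}).IsPrime := (Ideal.span_singleton_prime hp.ne_zero).2 hp
  let _ : Field (O ⧸ Ideal.span {π}) := Finite.isField_of_domain _ |>.toField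
  let _ := Fintype.ofFinite (O ⧸ Ideal.span {π})
  rw [← Ideal.mem_span_singleton, ← Ideal.Quotient.eq_zero_iff_mem, map_sub, map_pow, q,
    Nat.card_eq_fintype_card, FiniteField.pow_card, sub_self]

lemma q_pos : 0 < q π := by
  obtain ⟨p, h, hp, hq, -, -⟩ := exists_prime_pow π
  rw [hq]; exact pow_pos hp.pos _

lemma dvd_natCast_q : algebraMap O A π ∣ (q π : A) := by
  obtain ⟨p, h, hp, hq, hd, hh⟩ := exists_prime_pow π
  have : algebraMap O A π ∣ (p : A) := by simpa using map_dvd (algebraMap O A) hd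
  rw [hq, Nat.cast_pow]
  exact dvd_pow this hh

lemma dvd_add_pow_q (x y : A) : algebraMap O A π ∣ (x + y) ^ q π - (x ^ q π + y ^ q π) := by
  obtain ⟨p, h, hp, hq, hd, -⟩ := exists_prime_pow π
  have h1 : algebraMap O A π ∣ (p : A) := by simpa using map_dvd (algebraMap O A) hd
  rw [hq, add_pow_prime_pow_eq hp x y h, add_sub_cancel_left, mul_assoc, mul_assoc]
  exact h1.mul_right _

lemma dvd_pow_q_sub {a b : A} {k : ℕ} (h : algebraMap O A π ^ (k + 1) ∣ a - b) :
    algebraMap O A π ^ (k + 2) ∣ a ^ q π - b ^ q π := by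
  rw [← Commute.geom_sum₂_mul (Commute.all a b), pow_succ', ]
  refine mul_dvd_mul ?_ h
  have hab : algebraMap O A π ∣ a - b := (dvd_pow_self _ (Nat.succ_ne_zero k)).trans h
  have key : algebraMap O A π ∣
      ∑ i ∈ Finset.range (q π), (a ^ i * b ^ (q π - 1 - i) - b ^ i * b ^ (q π - 1 - i)) := by
    refine Finset.dvd_sum fun i _ => ?_
    rw [← sub_mul]
    exact (hab.trans (sub_dvd_pow_sub_pow a b i)).mul_right _
  have e : ∑ i ∈ Finset.range (q π), b ^ i * b ^ (q π - 1 - i) = (q π : A) * b ^ (q π - 1) := by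
    rw [Finset.sum_congr rfl (g := fun _ => b ^ (q π - 1))]
    · simp
    · intro i hi
      rw [← pow_add]
      congr 1
      have := Finset.mem_range.mp hi
      omega
  rw [Finset.sum_sub_distrib, e] at key
  exact (dvd_sub_left ((dvd_natCast_q π).mul_right _)).1 key

lemma dvd_pow_q_pow_sub {a b : A} (h : algebraMap O A π ∣ a - b) (k : ℕ) :
    algebraMap O A π ^ (k + 1) ∣ a ^ q π ^ k - b ^ q π ^ k := by
  induction k with
  | zero => simpa using h
  | succ k ih => rw [pow_succ (q π), pow_mul, pow_mul]; exact dvd_pow_q_sub π ih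

variable {π}

lemma dvd_wittPoly_succ (φ : A →ₐ[O] A) (hφ : ∀ a, algebraMap O A π ∣ φ a - a ^ q π)
    (x : ℕ → A) (i : ℕ) : algebraMap O A π ^ (i + 1) ∣
      φ (wittPoly π x i) - ∑ j ∈ Finset.range (i + 1),
        algebraMap O A (π ^ j) * x j ^ q π ^ (i + 1 - j) := by
  rw [map_wittPoly, wittPoly, ← Finset.sum_sub_distrib]
  refine Finset.dvd_sum fun j hj => ?_
  have hj' : j ≤ i := Nat.lt_succ_iff.mp (Finset.mem_range.mp hj)
  obtain ⟨k, rfl⟩ := Nat.exists_eq_add_of_le hj'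
  have h := dvd_pow_q_pow_sub π (hφ (x j)) k
  rw [← pow_mul, ← pow_succ'] at h
  rw [← mul_sub, map_pow, show j + k + 1 = j + (k + 1) by ring, pow_add,
    show j + k - j = k by omega, show j + (k + 1) - j = k + 1 by omega]
  exact mul_dvd_mul_left _ h

/-- A vector satisfying the Dwork congruences is in the image of the ghost map. -/
lemma exists_wittPoly_eq (φ : A →ₐ[O] A) (hφ : ∀ a, algebraMap O A π ∣ φ a - a ^ q π)
    (g : ℕ → A) (n : ℕ) (hg : ∀ i < n, algebraMap O A π ^ (i + 1) ∣ g (i + 1) - φ (g i)) :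
    ∃ x : ℕ → A, ∀ i ≤ n, wittPoly π x i = g i := by
  induction n with
  | zero =>
    refine ⟨fun _ => g 0, fun i hi => ?_⟩
    obtain rfl : i = 0 := by omega
    simp [wittPoly]
  | succ n ih =>
    obtain ⟨x, hx⟩ := ih fun i hi => hg i (by omega)
    have h1 := dvd_wittPoly_succ φ hφ x n
    have h2 := dvd_add (hg n (by omega)) h1
    rw [hx n le_rfl, sub_add_sub_cancel] at h2
    obtain ⟨y, hy⟩ := h2
    refine ⟨Function.update x (n + 1) y, fun i hi => ?_⟩
    rcases Nat.lt_or_ge i (n + 1) with hi' | hi'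
    · rw [← hx i (by omega)]
      refine wittPoly_congr π fun j hj => ?_
      rw [Function.update_of_ne (by omega)]
    · obtain rfl : i = n + 1 := by omega
      rw [wittPoly_succ_eq, Function.update_self, map_pow, ← hy]
      rw [Finset.sum_congr rfl (g := fun j => algebraMap O A (π ^ j) * x j ^ q π ^ (n + 1 - j))]
      · ring
      · intro j hj
        have := Finset.mem_range.mp hj
        rw [Function.update_of_ne (by omega)]

lemma dvd_wittPoly_sub (φ : A →ₐ[O] A) (hφ : ∀ a, algebraMap O A π ∣ φ a - a ^ q π)
    (x : ℕ → A) (i : ℕ) :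
    algebraMap O A π ^ (i + 1) ∣ wittPoly π x (i + 1) - φ (wittPoly π x i) := by
  have h1 := dvd_wittPoly_succ φ hφ x i
  rw [wittPoly_succ_eq π x (i + 1), add_sub_right_comm, ← neg_sub (φ _)]
  exact dvd_add ((dvd_neg).2 h1) (by rw [map_pow]; exact dvd_mul_right _ _)

end Lemmas

lemma mvPolynomial_torsionFree [IsDomain O] [hπ : Fact (Prime π)] {σ : Type w} (a : MvPolynomial σ O)
    (h : algebraMap O (MvPolynomial σ O) π * a = 0) : a = 0 := by
  rcases mul_eq_zero.1 h with h | h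
  · rw [MvPolynomial.algebraMap_eq, MvPolynomial.C_eq_zero] at h
    exact absurd h hπ.out.ne_zero
  · exact h

variable [hπ : Fact (Prime π)] [Finite (O ⧸ Ideal.span {π})]

/-- An `O`-algebra endomorphism of a polynomial ring over `O` lifts the `q`-power Frobenius as
soon as it does so on the variables. -/
lemma mvPolynomial_frobenius {σ : Type w} (φ : MvPolynomial σ O →ₐ[O] MvPolynomial σ O)
    (h : ∀ s, algebraMap O (MvPolynomial σ O) π ∣
      φ (MvPolynomial.X s) - MvPolynomial.X s ^ q π) (f : MvPolynomial σ O) :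
    algebraMap O (MvPolynomial σ O) π ∣ φ f - f ^ q π := by
  induction f using MvPolynomial.induction_on with
  | C c =>
    have := map_dvd (algebraMap O (MvPolynomial σ O)) (dvd_sub_pow_q π c)
    rw [← MvPolynomial.algebraMap_eq, AlgHom.commutes]
    simpa using this
  | add f g hf hg =>
    have := dvd_sub (dvd_add hf hg) (dvd_add_pow_q π f g)
    rw [map_add]
    convert this using 1
    ring
  | mul_X f s hf =>
    have := dvd_add (hf.mul_right (φ (MvPolynomial.X s))) ((h s).mul_left (f ^ q π))
    rw [map_mul, mul_pow]
    convert this using 1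
    ring

/-- The lift of Frobenius on a polynomial ring raising each variable to the `q`-th power. -/
noncomputable def powFrob (σ : Type w) : MvPolynomial σ O →ₐ[O] MvPolynomial σ O :=
  MvPolynomial.aeval fun s => MvPolynomial.X s ^ q π

lemma powFrob_spec (σ : Type w) (f : MvPolynomial σ O) :
    algebraMap O (MvPolynomial σ O) π ∣ powFrob π σ f - f ^ q π :=
  mvPolynomial_frobenius π _ (fun s => by simp [powFrob]) f

/-- The two generic vectors, with entries `X (b, j)`. -/
noncomputable abbrev gen (b : Bool) (j : ℕ) : MvPolynomial (Bool × ℕ) O := MvPolynomial.X (b, j)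

lemma exists_addPoly (n : ℕ) : ∃ z : ℕ → MvPolynomial (Bool × ℕ) O, ∀ i ≤ n,
    wittPoly π z i = wittPoly π (gen false) i + wittPoly π (gen true) i := by
  refine exists_wittPoly_eq (powFrob π _) (powFrob_spec π _) _ n fun i _ => ?_
  have := dvd_add (dvd_wittPoly_sub (powFrob π _) (powFrob_spec π _) (gen (O := O) false) i)
    (dvd_wittPoly_sub (powFrob π _) (powFrob_spec π _) (gen (O := O) true) i)
  rw [map_add]
  convert this using 1
  ring

lemma exists_mulPoly (n : ℕ) : ∃ z : ℕ → MvPolynomial (Bool × ℕ) O, ∀ i ≤ n,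
    wittPoly π z i = wittPoly π (gen false) i * wittPoly π (gen true) i := by
  refine exists_wittPoly_eq (powFrob π _) (powFrob_spec π _) _ n fun i _ => ?_
  have := dvd_add ((dvd_wittPoly_sub (powFrob π _) (powFrob_spec π _) (gen (O := O) false) i).mul_right
      (wittPoly π (gen true) (i + 1)))
    ((dvd_wittPoly_sub (powFrob π _) (powFrob_spec π _) (gen (O := O) true) i).mul_left
      (powFrob π _ (wittPoly π (gen false) i)))
  rw [map_mul]
  convert this using 1
  ring

lemma exists_negPoly (n : ℕ) : ∃ z : ℕ → MvPolynomial (Bool × ℕ) O, ∀ i ≤ n,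
    wittPoly π z i = - wittPoly π (gen false) i := by
  refine exists_wittPoly_eq (powFrob π _) (powFrob_spec π _) _ n fun i _ => ?_
  have := (dvd_wittPoly_sub (powFrob π _) (powFrob_spec π _) (gen (O := O) false) i).neg_right
  rw [map_neg]
  convert this using 1
  ring

lemma exists_constSeq (n : ℕ) (c : O) : ∃ z : ℕ → O, ∀ i ≤ n, wittPoly π z i = c := by
  refine exists_wittPoly_eq (AlgHom.id O O) (fun a => ?_) (fun _ => c) n fun i _ => ?_
  · simpa using dvd_sub_pow_q π a
  · simp

/-- The polynomials computing the sum of two Witt vectors of length `n + 1`: the universal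
polynomials over `O` with `w_i(S) = w_i(X) + w_i(Y)` for `0 ≤ i ≤ n`. -/
noncomputable def addPoly (n : ℕ) : ℕ → MvPolynomial (Bool × ℕ) O := (exists_addPoly π n).choose

/-- The polynomials computing the product of two Witt vectors: `w_i(M) = w_i(X) w_i(Y)`. -/
noncomputable def mulPoly (n : ℕ) : ℕ → MvPolynomial (Bool × ℕ) O := (exists_mulPoly π n).choose

/-- The polynomials computing the opposite of a Witt vector: `w_i(N) = - w_i(X)`. -/
noncomputable def negPoly (n : ℕ) : ℕ → MvPolynomial (Bool × ℕ) O := (exists_negPoly π n).choose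

/-- The Witt coordinates over `O` of the constant ghost vector `(c, …, c)`. -/
noncomputable def constSeq (n : ℕ) (c : O) : ℕ → O := (exists_constSeq π n c).choose

end Witt

/-- The set `W_n(B) = B ^ (n + 1)` of truncated `π`-typical Witt vectors `(b_0, …, b_n)`. -/
@[ext]
structure PiWitt {O : Type v} (π : O) (n : ℕ) (B : Type w) where
  /-- The Witt coordinates. -/
  coeff : Fin (n + 1) → B

namespace PiWitt

variable {O : Type v} [CommRing O] {π : O} {n : ℕ}
variable {A : Type w} [CommRing A] [Algebra O A] {B : Type u} [CommRing B] [Algebra O B]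

/-- The Witt coordinates, extended by zero. -/
def seq (x : PiWitt π n B) (j : ℕ) : B := if h : j < n + 1 then x.coeff ⟨j, h⟩ else 0

/-- The Witt vector given by the first `n + 1` terms of a sequence. -/
def ofSeq (π : O) (n : ℕ) (z : ℕ → B) : PiWitt π n B := ⟨fun k => z k⟩

/-- The `i`-th ghost component, for `0 ≤ i ≤ n`. -/
noncomputable def ghost (x : PiWitt π n B) (i : ℕ) : B := wittPoly π x.seq i

lemma seq_ofSeq (z : ℕ → B) {j : ℕ} (h : j ≤ n) : (ofSeq π n z).seq j = z j := by
  simp [seq, ofSeq, Nat.lt_succ_iff.2 h]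

lemma seq_val (x : PiWitt π n B) (k : Fin (n + 1)) : x.seq k = x.coeff k := by
  simp only [seq, k.2, dite_true]

lemma ghost_ofSeq (z : ℕ → B) {i : ℕ} (h : i ≤ n) : (ofSeq π n z).ghost i = wittPoly π z i :=
  wittPoly_congr π fun j hj => seq_ofSeq z (hj.trans h)

/-- A pair of Witt vectors as a valuation of the generic coordinates. -/
def pair (x y : PiWitt π n B) (s : Bool × ℕ) : B := bif s.1 then y.seq s.2 else x.seq s.2

/-- Functoriality of `W_n` as a map of sets. -/
def mapFun (f : A → B) (x : PiWitt π n A) : PiWitt π n B := ⟨fun k => f (x.coeff k)⟩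

lemma seq_mapFun (f : A →ₐ[O] B) (x : PiWitt π n A) (j : ℕ) :
    (mapFun f x).seq j = f (x.seq j) := by
  unfold seq mapFun
  split <;> simp

lemma ghost_mapFun (f : A →ₐ[O] B) (x : PiWitt π n A) (i : ℕ) :
    (mapFun f x).ghost i = f (x.ghost i) := by
  rw [ghost, ghost, map_wittPoly]
  congr 1
  funext j
  exact seq_mapFun f x j

lemma ext_ghost (hB : ∀ a : B, algebraMap O B π * a = 0 → a = 0) {x y : PiWitt π n B}
    (h : ∀ i ≤ n, x.ghost i = y.ghost i) : x = y := by
  ext k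
  rw [← seq_val, ← seq_val]
  exact eq_of_wittPoly_eq hB h k (Nat.lt_succ_iff.1 k.2)

variable [Fact (Prime π)] [Finite (O ⧸ Ideal.span {π})]

noncomputable instance : Add (PiWitt π n B) :=
  ⟨fun x y => ofSeq π n fun k => MvPolynomial.aeval (pair x y) (addPoly π n k)⟩

noncomputable instance : Mul (PiWitt π n B) :=
  ⟨fun x y => ofSeq π n fun k => MvPolynomial.aeval (pair x y) (mulPoly π n k)⟩

noncomputable instance : Neg (PiWitt π n B) :=
  ⟨fun x => ofSeq π n fun k => MvPolynomial.aeval (pair x x) (negPoly π n k)⟩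

/-- The image of `c : O` in `W_n(B)`: the Witt vector whose ghost components all equal `c`. -/
noncomputable def const (π : O) [Fact (Prime π)] [Finite (O ⧸ Ideal.span {π})] (n : ℕ)
    (B : Type u) [CommRing B] [Algebra O B] (c : O) : PiWitt π n B :=
  ofSeq π n fun k => algebraMap O B (constSeq π n c k)

noncomputable instance : Zero (PiWitt π n B) := ⟨const π n B 0⟩

noncomputable instance : One (PiWitt π n B) := ⟨const π n B 1⟩

lemma ghost_add (x y : PiWitt π n B) {i : ℕ} (h : i ≤ n) :
    (x + y).ghost i = x.ghost i + y.ghost i := by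
  refine (ghost_ofSeq _ h).trans ?_
  rw [← map_wittPoly, addPoly, (exists_addPoly π n).choose_spec i h, map_add, map_wittPoly,
    map_wittPoly]
  simp [pair, gen, ghost]

lemma ghost_mul (x y : PiWitt π n B) {i : ℕ} (h : i ≤ n) :
    (x * y).ghost i = x.ghost i * y.ghost i := by
  refine (ghost_ofSeq _ h).trans ?_
  rw [← map_wittPoly, mulPoly, (exists_mulPoly π n).choose_spec i h, map_mul, map_wittPoly,
    map_wittPoly]
  simp [pair, gen, ghost]

lemma ghost_neg (x : PiWitt π n B) {i : ℕ} (h : i ≤ n) : (-x).ghost i = - x.ghost i := by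
  refine (ghost_ofSeq _ h).trans ?_
  rw [← map_wittPoly, negPoly, (exists_negPoly π n).choose_spec i h, map_neg, map_wittPoly]
  simp [pair, gen, ghost]

lemma ghost_const (c : O) {i : ℕ} (h : i ≤ n) :
    (const π n B c).ghost i = algebraMap O B c := by
  refine (ghost_ofSeq _ h).trans ?_
  have := map_wittPoly π (Algebra.ofId O B) (constSeq π n c) i
  rw [constSeq, (exists_constSeq π n c).choose_spec i h] at this
  exact this.symm

lemma ghost_zero {i : ℕ} (h : i ≤ n) : (0 : PiWitt π n B).ghost i = 0 :=
  (ghost_const 0 h).trans (map_zero _)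

lemma ghost_one {i : ℕ} (h : i ≤ n) : (1 : PiWitt π n B).ghost i = 1 :=
  (ghost_const 1 h).trans (map_one _)

lemma mapFun_ofSeq (f : A →ₐ[O] B) (z : ℕ → A) :
    mapFun f (ofSeq π n z) = ofSeq π n fun k => f (z k) := rfl

lemma comp_pair (f : A →ₐ[O] B) (x y : PiWitt π n A) :
    (fun s => f (pair x y s)) = pair (mapFun f x) (mapFun f y) := by
  funext ⟨b, j⟩
  cases b <;> simp [pair, seq_mapFun]

lemma mapFun_add (f : A →ₐ[O] B) (x y : PiWitt π n A) :
    mapFun f (x + y) = mapFun f x + mapFun f y := by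
  refine (mapFun_ofSeq f _).trans ?_
  simp only [MvPolynomial.comp_aeval_apply, comp_pair]
  rfl

lemma mapFun_mul (f : A →ₐ[O] B) (x y : PiWitt π n A) :
    mapFun f (x * y) = mapFun f x * mapFun f y := by
  refine (mapFun_ofSeq f _).trans ?_
  simp only [MvPolynomial.comp_aeval_apply, comp_pair]
  rfl

lemma mapFun_neg (f : A →ₐ[O] B) (x : PiWitt π n A) : mapFun f (-x) = -mapFun f x := by
  refine (mapFun_ofSeq f _).trans ?_
  simp only [MvPolynomial.comp_aeval_apply, comp_pair]
  rfl

lemma mapFun_const (f : A →ₐ[O] B) (c : O) : mapFun f (const π n A c) = const π n B c := by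
  refine (mapFun_ofSeq f _).trans ?_
  simp [const]


lemma exists_lift {m : ℕ} (x : Fin m → PiWitt π n B) :
    ∃ y : Fin m → PiWitt π n (MvPolynomial B O),
      ∀ i, x i = mapFun (MvPolynomial.aeval (R := O) (id : B → B)) (y i) :=
  ⟨fun i => ⟨fun k => MvPolynomial.X ((x i).coeff k)⟩, fun i => by ext k; simp [mapFun]⟩

section Laws

variable [IsDomain O]

lemma mvExt {σ : Type w} {x y : PiWitt π n (MvPolynomial σ O)}
    (h : ∀ i ≤ n, x.ghost i = y.ghost i) : x = y :=
  ext_ghost (fun a => mvPolynomial_torsionFree π a) h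

/-- Three Witt vectors over `B` lift to Witt vectors over a polynomial ring. -/
lemma induction_three {P : PiWitt π n B → PiWitt π n B → PiWitt π n B → Prop}
    (h : ∀ x y z : PiWitt π n (MvPolynomial B O),
      P (mapFun (MvPolynomial.aeval (R := O) (id : B → B)) x)
        (mapFun (MvPolynomial.aeval (R := O) (id : B → B)) y)
        (mapFun (MvPolynomial.aeval (R := O) (id : B → B)) z)) (x y z : PiWitt π n B) :
    P x y z := by
  obtain ⟨t, ht⟩ := exists_lift ![x, y, z]
  have h0 := ht 0
  have h1 := ht 1
  have h2 := ht 2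
  simp only [Matrix.cons_val] at h0 h1 h2
  rw [h0, h1, h2]
  exact h _ _ _

lemma mapFun_zero (f : A →ₐ[O] B) : mapFun f (0 : PiWitt π n A) = 0 := mapFun_const f 0

lemma mapFun_one (f : A →ₐ[O] B) : mapFun f (1 : PiWitt π n A) = 1 := mapFun_const f 1

noncomputable instance : CommRing (PiWitt π n B) where
  add_assoc := induction_three fun x y z => by
    simp only [← mapFun_add]
    exact congrArg _ (mvExt fun i hi => by simp only [ghost_add _ _ hi]; ring)
  zero_add x := induction_three (P := fun x _ _ => 0 + x = x) (fun x _ _ => by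
    rw [← mapFun_zero (MvPolynomial.aeval (R := O) (id : B → B)), ← mapFun_add]
    exact congrArg _ (mvExt fun i hi => by
      simp only [ghost_add _ _ hi, ghost_zero hi]; ring)) x x x
  add_zero x := induction_three (P := fun x _ _ => x + 0 = x) (fun x _ _ => by
    rw [← mapFun_zero (MvPolynomial.aeval (R := O) (id : B → B)), ← mapFun_add]
    exact congrArg _ (mvExt fun i hi => by
      simp only [ghost_add _ _ hi, ghost_zero hi]; ring)) x x x
  add_comm x y := induction_three (P := fun x y _ => x + y = y + x) (fun x y _ => by
    simp only [← mapFun_add]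
    exact congrArg _ (mvExt fun i hi => by simp only [ghost_add _ _ hi]; ring)) x y y
  mul_assoc := induction_three fun x y z => by
    simp only [← mapFun_mul]
    exact congrArg _ (mvExt fun i hi => by simp only [ghost_mul _ _ hi]; ring)
  mul_comm x y := induction_three (P := fun x y _ => x * y = y * x) (fun x y _ => by
    simp only [← mapFun_mul]
    exact congrArg _ (mvExt fun i hi => by simp only [ghost_mul _ _ hi]; ring)) x y y
  one_mul x := induction_three (P := fun x _ _ => 1 * x = x) (fun x _ _ => by
    rw [← mapFun_one (MvPolynomial.aeval (R := O) (id : B → B)), ← mapFun_mul]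
    exact congrArg _ (mvExt fun i hi => by
      simp only [ghost_mul _ _ hi, ghost_one hi]; ring)) x x x
  mul_one x := induction_three (P := fun x _ _ => x * 1 = x) (fun x _ _ => by
    rw [← mapFun_one (MvPolynomial.aeval (R := O) (id : B → B)), ← mapFun_mul]
    exact congrArg _ (mvExt fun i hi => by
      simp only [ghost_mul _ _ hi, ghost_one hi]; ring)) x x x
  zero_mul x := induction_three (P := fun x _ _ => 0 * x = 0) (fun x _ _ => by
    rw [← mapFun_zero (MvPolynomial.aeval (R := O) (id : B → B)), ← mapFun_mul]
    exact congrArg _ (mvExt fun i hi => by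
      simp only [ghost_mul _ _ hi, ghost_zero hi]; ring)) x x x
  mul_zero x := induction_three (P := fun x _ _ => x * 0 = 0) (fun x _ _ => by
    rw [← mapFun_zero (MvPolynomial.aeval (R := O) (id : B → B)), ← mapFun_mul]
    exact congrArg _ (mvExt fun i hi => by
      simp only [ghost_mul _ _ hi, ghost_zero hi]; ring)) x x x
  left_distrib := induction_three fun x y z => by
    simp only [← mapFun_mul, ← mapFun_add]
    exact congrArg _ (mvExt fun i hi => by simp only [ghost_mul _ _ hi, ghost_add _ _ hi]; ring)
  right_distrib := induction_three fun x y z => by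
    simp only [← mapFun_mul, ← mapFun_add]
    exact congrArg _ (mvExt fun i hi => by simp only [ghost_mul _ _ hi, ghost_add _ _ hi]; ring)
  neg_add_cancel x := induction_three (P := fun x _ _ => -x + x = 0) (fun x _ _ => by
    rw [← mapFun_zero (MvPolynomial.aeval (R := O) (id : B → B)), ← mapFun_neg, ← mapFun_add]
    exact congrArg _ (mvExt fun i hi => by
      simp only [ghost_add _ _ hi, ghost_neg _ hi, ghost_zero hi]; ring)) x x x
  nsmul := nsmulRec
  zsmul := zsmulRec

lemma base_torsionFree (a : O) (h : algebraMap O O π * a = 0) : a = 0 :=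
  (mul_eq_zero.1 h).resolve_left (Fact.out : Prime π).ne_zero

lemma const_add (c d : O) : const π n B (c + d) = const π n B c + const π n B d := by
  rw [← mapFun_const (Algebra.ofId O B), ← mapFun_const (Algebra.ofId O B) c,
    ← mapFun_const (Algebra.ofId O B) d, ← mapFun_add]
  refine congrArg _ (ext_ghost base_torsionFree fun i hi => ?_)
  simp [ghost_add _ _ hi, ghost_const _ hi]

lemma const_mul (c d : O) : const π n B (c * d) = const π n B c * const π n B d := by
  rw [← mapFun_const (Algebra.ofId O B), ← mapFun_const (Algebra.ofId O B) c,
    ← mapFun_const (Algebra.ofId O B) d, ← mapFun_mul]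
  refine congrArg _ (ext_ghost base_torsionFree fun i hi => ?_)
  simp [ghost_mul _ _ hi, ghost_const _ hi]

noncomputable instance : Algebra O (PiWitt π n B) :=
  RingHom.toAlgebra
    { toFun := const π n B
      map_zero' := rfl
      map_one' := rfl
      map_add' := const_add
      map_mul' := const_mul }

lemma algebraMap_eq_const (c : O) : algebraMap O (PiWitt π n B) c = const π n B c := rfl

/-- Functoriality of `W_n`. -/
noncomputable def map (n : ℕ) (f : A →ₐ[O] B) : PiWitt π n A →ₐ[O] PiWitt π n B where
  toFun := mapFun f
  map_zero' := mapFun_zero f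
  map_one' := mapFun_one f
  map_add' := mapFun_add f
  map_mul' := mapFun_mul f
  commutes' := mapFun_const f

@[simp]
lemma coeff_map (f : A →ₐ[O] B) (x : PiWitt π n A) (k : Fin (n + 1)) :
    (map n f x).coeff k = f (x.coeff k) := rfl

lemma ghost_map (f : A →ₐ[O] B) (x : PiWitt π n A) (i : ℕ) :
    (map n f x).ghost i = f (x.ghost i) := ghost_mapFun f x i

end Laws

end PiWitt

section PiDerivation

variable {O : Type v} [CommRing O] (π : O) [hπ : Fact (Prime π)]
  [Finite (O ⧸ Ideal.span {π})]

lemma exists_cPoly : ∃ C : MvPolynomial (Fin 2) O, MvPolynomial.C π * C =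
    MvPolynomial.X 0 ^ q π + MvPolynomial.X 1 ^ q π
      - (MvPolynomial.X 0 + MvPolynomial.X 1) ^ q π := by
  obtain ⟨C, hC⟩ := dvd_add_pow_q (O := O) π (MvPolynomial.X 0 : MvPolynomial (Fin 2) O)
    (MvPolynomial.X 1)
  refine ⟨-C, ?_⟩
  rw [← MvPolynomial.algebraMap_eq, mul_neg, ← hC, neg_sub]

/-- The polynomial `C_π(X, Y) = (X ^ q + Y ^ q - (X + Y) ^ q) / π` over `O`. -/
noncomputable def cPoly : MvPolynomial (Fin 2) O := (exists_cPoly π).choose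

lemma cPoly_spec : MvPolynomial.C π * cPoly π =
    MvPolynomial.X 0 ^ q π + MvPolynomial.X 1 ^ q π
      - (MvPolynomial.X 0 + MvPolynomial.X 1) ^ q π := (exists_cPoly π).choose_spec

/-- The value `C_π(x, y)` in an `O`-algebra. -/
noncomputable def cVal {B : Type w} [CommRing B] [Algebra O B] (x y : B) : B :=
  MvPolynomial.aeval ![x, y] (cPoly π)

/-- The `π`-derivation `δ(x) = (x - x ^ q) / π` of `O`. -/
noncomputable def baseDelta (c : O) : O := (dvd_sub_pow_q π c).choose

lemma baseDelta_spec (c : O) : π * baseDelta π c = c - c ^ q π :=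
  (dvd_sub_pow_q π c).choose_spec.symm

lemma cVal_spec {B : Type w} [CommRing B] [Algebra O B] (x y : B) :
    algebraMap O B π * cVal π x y = x ^ q π + y ^ q π - (x + y) ^ q π := by
  have h := congrArg (MvPolynomial.aeval ![x, y]) (cPoly_spec π)
  simpa [cVal] using h

lemma map_cVal {A : Type w} [CommRing A] [Algebra O A] {B : Type u} [CommRing B] [Algebra O B]
    (f : A →ₐ[O] B) (x y : A) : f (cVal π x y) = cVal π (f x) (f y) := by
  rw [cVal, cVal, MvPolynomial.comp_aeval_apply]
  congr 2
  funext i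
  fin_cases i <;> rfl

/-- A `π`-derivation `δ : A → B` relative to the morphism of `O`-algebras `u : A → B`. -/
structure IsPiDerivation {A : Type w} [CommRing A] [Algebra O A] {B : Type u} [CommRing B]
    [Algebra O B] (u : A →ₐ[O] B) (δ : A → B) : Prop where
  add : ∀ x y, δ (x + y) = δ x + δ y + cVal π (u x) (u y)
  mul : ∀ x y, δ (x * y) =
    u x ^ q π * δ y + u y ^ q π * δ x + algebraMap O B π * (δ x * δ y)

namespace PiWitt

variable {π}
variable {A : Type w} [CommRing A] [Algebra O A] {B : Type u} [CommRing B] [Algebra O B]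

lemma ghost_zero_eq {n : ℕ} (x : PiWitt π n B) : x.ghost 0 = x.coeff 0 := by
  simp [ghost, wittPoly, seq]

lemma ghost_one_eq (x : PiWitt π 1 B) :
    x.ghost 1 = x.coeff 0 ^ q π + algebraMap O B π * x.coeff 1 := by
  simp [ghost, wittPoly, seq, Finset.sum_range_succ]

variable [IsDomain O]

lemma mvExt_one {σ : Type w} {x y : PiWitt π 1 (MvPolynomial σ O)}
    (h0 : x.coeff 0 = y.coeff 0) (h1 : x.ghost 1 = y.ghost 1) : x = y := by
  refine mvExt fun i hi => ?_
  obtain rfl | rfl : i = 0 ∨ i = 1 := by omega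
  · rw [ghost_zero_eq, ghost_zero_eq, h0]
  · exact h1

/-- The elements of `W_1(B)` are the pairs of elements of `B`. -/
def mk₁ (π : O) (a b : B) : PiWitt π 1 B := ⟨![a, b]⟩

lemma mapFun_mk₁ (f : A → B) (a b : A) : mapFun f (mk₁ π a b) = mk₁ π (f a) (f b) := by
  ext k
  fin_cases k <;> rfl

lemma add_eq₁ (x y : PiWitt π 1 B) : x + y =
    mk₁ π (x.coeff 0 + y.coeff 0) (x.coeff 1 + y.coeff 1 + cVal π (x.coeff 0) (y.coeff 0)) := by
  refine induction_three (P := fun x y _ => x + y = mk₁ π (x.coeff 0 + y.coeff 0)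
    (x.coeff 1 + y.coeff 1 + cVal π (x.coeff 0) (y.coeff 0))) (fun x y _ => ?_) x y y
  have : x + y = mk₁ π (x.coeff 0 + y.coeff 0)
      (x.coeff 1 + y.coeff 1 + cVal π (x.coeff 0) (y.coeff 0)) := by
    refine mvExt_one ?_ ?_
    · rw [← ghost_zero_eq, ghost_add _ _ (by omega), ghost_zero_eq, ghost_zero_eq]; rfl
    · rw [ghost_add _ _ le_rfl, ghost_one_eq, ghost_one_eq, ghost_one_eq]
      simp only [mk₁, Matrix.cons_val_zero, Matrix.cons_val_one]
      rw [mul_add, mul_add, cVal_spec]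
      ring
  rw [← mapFun_add, this, mapFun_mk₁]
  simp only [map_add, map_cVal]
  rfl

lemma mul_eq₁ (x y : PiWitt π 1 B) : x * y = mk₁ π (x.coeff 0 * y.coeff 0)
    (x.coeff 0 ^ q π * y.coeff 1 + y.coeff 0 ^ q π * x.coeff 1 +
      algebraMap O B π * (x.coeff 1 * y.coeff 1)) := by
  refine induction_three (P := fun x y _ => x * y = mk₁ π (x.coeff 0 * y.coeff 0)
    (x.coeff 0 ^ q π * y.coeff 1 + y.coeff 0 ^ q π * x.coeff 1 +
      algebraMap O B π * (x.coeff 1 * y.coeff 1))) (fun x y _ => ?_) x y y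
  have : x * y = mk₁ π (x.coeff 0 * y.coeff 0)
      (x.coeff 0 ^ q π * y.coeff 1 + y.coeff 0 ^ q π * x.coeff 1 +
        algebraMap O _ π * (x.coeff 1 * y.coeff 1)) := by
    refine mvExt_one ?_ ?_
    · rw [← ghost_zero_eq, ghost_mul _ _ (by omega), ghost_zero_eq, ghost_zero_eq]; rfl
    · rw [ghost_mul _ _ le_rfl, ghost_one_eq, ghost_one_eq, ghost_one_eq]
      simp only [mk₁, Matrix.cons_val_zero, Matrix.cons_val_one]
      ring
  rw [← mapFun_mul, this, mapFun_mk₁]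
  simp only [map_add, map_mul, map_pow, AlgHom.commutes]
  rfl

lemma const_eq₁ (c : O) : const π 1 B c =
    mk₁ π (algebraMap O B c) (algebraMap O B (baseDelta π c)) := by
  have : const π 1 O c = mk₁ π c (baseDelta π c) := by
    refine ext_ghost base_torsionFree fun i hi => ?_
    obtain rfl | rfl : i = 0 ∨ i = 1 := by omega
    · rw [ghost_const _ hi, ghost_zero_eq]; rfl
    · rw [ghost_const _ hi, ghost_one_eq]
      simp [mk₁, baseDelta_spec]
  rw [← mapFun_const (Algebra.ofId O B), this, mapFun_mk₁]
  rfl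

/-- The projection `W_n(B) → B` to the zeroth coordinate. -/
noncomputable def coeffZero (n : ℕ) : PiWitt π n B →ₐ[O] B :=
  { toFun := fun x => x.coeff 0
    map_zero' := by
      rw [← ghost_zero_eq, ghost_zero (by omega)]
    map_one' := by
      rw [← ghost_zero_eq, ghost_one (by omega)]
    map_add' := fun x y => by
      simp only [← ghost_zero_eq, ghost_add _ _ (Nat.zero_le n)]
    map_mul' := fun x y => by
      simp only [← ghost_zero_eq, ghost_mul _ _ (Nat.zero_le n)]
    commutes' := fun c => by
      rw [← ghost_zero_eq]; exact ghost_const _ (Nat.zero_le n) }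

/-- A prolongation `(u, δ)` from `A` to `B`, compatible with the `π`-derivation of `O`, as a
morphism of `O`-algebras `A → W_1(B)`, `a ↦ (u a, δ a)`. -/
noncomputable def ofPiDerivation (u : A →ₐ[O] B) (δ : A → B) (h : IsPiDerivation π u δ)
    (hO : ∀ c : O, δ (algebraMap O A c) = algebraMap O B (baseDelta π c)) :
    A →ₐ[O] PiWitt π 1 B where
  toFun a := mk₁ π (u a) (δ a)
  map_zero' := by
    rw [← map_zero (algebraMap O A), hO, AlgHom.commutes, ← const_eq₁]; rfl
  map_one' := by
    rw [← map_one (algebraMap O A), hO, AlgHom.commutes, ← const_eq₁]; rfl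
  map_add' x y := by rw [add_eq₁, h.add, map_add]; rfl
  map_mul' x y := by rw [mul_eq₁, h.mul, map_mul]; rfl
  commutes' c := by rw [hO, AlgHom.commutes, ← const_eq₁]; rfl

/-- Conversely a morphism of `O`-algebras `A → W_1(B)` yields a `π`-derivation. -/
lemma isPiDerivation (f : A →ₐ[O] PiWitt π 1 B) (u : A →ₐ[O] B)
    (hu : ∀ a, (f a).coeff 0 = u a) : IsPiDerivation π u fun a => (f a).coeff 1 where
  add x y := by
    simp only [map_add, add_eq₁, hu]; rfl
  mul x y := by
    simp only [map_mul, mul_eq₁, hu]; rfl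

lemma coeff_one_algebraMap (f : A →ₐ[O] PiWitt π 1 B) (c : O) :
    (f (algebraMap O A c)).coeff 1 = algebraMap O B (baseDelta π c) := by
  rw [AlgHom.commutes, algebraMap_eq_const, const_eq₁]; rfl

lemma baseDelta_zero : baseDelta π (0 : O) = 0 := by
  have := baseDelta_spec π 0
  rw [zero_pow (q_pos π).ne', sub_zero] at this
  exact (mul_eq_zero.1 this).resolve_left (Fact.out : Prime π).ne_zero

lemma coeff_one_zero : (0 : PiWitt π 1 B).coeff 1 = 0 := by
  have : (const π 1 B 0).coeff 1 = 0 := by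
    rw [const_eq₁, baseDelta_zero]; simp [mk₁]
  exact this

lemma ext₁ {x y : PiWitt π 1 B} (h0 : x.coeff 0 = y.coeff 0) (h1 : x.coeff 1 = y.coeff 1) :
    x = y := by
  ext k
  fin_cases k
  exacts [h0, h1]

end PiWitt

end PiDerivation

section Prolongation

variable {O : Type v} [CommRing O]

/-- A prolongation sequence `R_0 ⇉ R_1 ⇉ R_2 ⇉ ⋯` of `O`-algebras over the constant prolongation
sequence `O_*`. -/
structure ProlongationSequence (π : O) [Fact (Prime π)] [Finite (O ⧸ Ideal.span {π})] where
  /-- The `O`-algebras of the sequence. -/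
  ring : ℕ → Type w
  [commRing : ∀ n, CommRing (ring n)]
  [algebra : ∀ n, Algebra O (ring n)]
  /-- The morphisms of `O`-algebras `u_n`. -/
  u : ∀ n, ring n →ₐ[O] ring (n + 1)
  /-- The `π`-derivations `δ_n` relative to `u_n`. -/
  δ : ∀ n, ring n → ring (n + 1)
  isPiDerivation : ∀ n, IsPiDerivation π (u n) (δ n)
  u_δ : ∀ n x, u (n + 1) (δ n x) = δ (n + 1) (u n x)
  /-- The structure morphisms `O → R_n` form a morphism of prolongation sequences `O_* → R_*`. -/
  δ_algebraMap : ∀ n (c : O),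
    δ n (algebraMap O (ring n) c) = algebraMap O (ring (n + 1)) (baseDelta π c)

attribute [instance] ProlongationSequence.commRing ProlongationSequence.algebra

variable {π : O} [Fact (Prime π)] [Finite (O ⧸ Ideal.span {π})]

namespace ProlongationSequence

/-- A morphism of prolongation sequences. -/
structure Hom (R : ProlongationSequence.{v, w} π) (S : ProlongationSequence.{v, u} π) where
  /-- The components. -/
  app : ∀ n, R.ring n →ₐ[O] S.ring n
  app_u : ∀ n x, app (n + 1) (R.u n x) = S.u n (app n x)
  app_δ : ∀ n x, app (n + 1) (R.δ n x) = S.δ n (app n x)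

/-- The identity morphism. -/
def Hom.id (R : ProlongationSequence.{v, w} π) : Hom R R where
  app n := AlgHom.id O _
  app_u _ _ := rfl
  app_δ _ _ := rfl

variable (R : ProlongationSequence.{v, w} π)

/-- For `i ≤ n`, the image in `R_n` of `δ ^ i c ∈ R_i`, where `c ∈ R_0`. -/
def deriv : ∀ n : ℕ, R.ring 0 → ℕ → R.ring n
  | 0, c, _ => c
  | n + 1, c, i => if i = n + 1 then R.δ n (deriv n c n) else R.u n (deriv n c i)

variable {R}

lemma u_deriv {n i : ℕ} (h : i ≤ n) (c : R.ring 0) :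
    R.u n (R.deriv n c i) = R.deriv (n + 1) c i := by
  rw [deriv, if_neg (by omega)]

lemma δ_deriv {n i : ℕ} (h : i ≤ n) (c : R.ring 0) :
    R.δ n (R.deriv n c i) = R.deriv (n + 1) c (i + 1) := by
  induction n with
  | zero =>
    obtain rfl : i = 0 := by omega
    simp [deriv]
  | succ n ih =>
    rcases Nat.lt_or_ge i (n + 1) with h' | h'
    · rw [← u_deriv (by omega), ← R.u_δ, ih (by omega), u_deriv (by omega)]
    · obtain rfl : i = n + 1 := by omega
      conv_rhs => rw [deriv, if_pos rfl]

lemma Hom.app_deriv {S : ProlongationSequence.{v, u} π} (f : Hom R S) (n i : ℕ) (c : R.ring 0) :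
    f.app n (R.deriv n c i) = S.deriv n (f.app 0 c) i := by
  induction n generalizing i with
  | zero => rfl
  | succ n ih =>
    simp only [deriv]
    split
    · rw [f.app_δ, ih]
    · rw [f.app_u, ih]

variable (R)

/-- The constant prolongation sequence `O_*`. -/
noncomputable abbrev base (π : O) [Fact (Prime π)] [Finite (O ⧸ Ideal.span {π})] [IsDomain O] :
    ProlongationSequence.{v, v} π where
  ring _ := O
  u _ := AlgHom.id O O
  δ _ := baseDelta π
  isPiDerivation _ := by
    have h := PiWitt.isPiDerivation (Algebra.ofId O (PiWitt π 1 O)) (AlgHom.id O O) (fun c => by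
      rw [Algebra.ofId_apply, PiWitt.algebraMap_eq_const, PiWitt.const_eq₁]; rfl)
    convert h using 2 with c
    rw [Algebra.ofId_apply, PiWitt.algebraMap_eq_const, PiWitt.const_eq₁]; rfl
  u_δ _ _ := rfl
  δ_algebraMap _ _ := rfl

variable [IsDomain O]

lemma deriv_zero (R : ProlongationSequence.{v, w} π) (n i : ℕ) : R.deriv n 0 i = 0 := by
  have hδ : ∀ n, R.δ n 0 = 0 := fun n => by
    have := R.δ_algebraMap n 0
    rwa [map_zero, PiWitt.baseDelta_zero, map_zero] at this
  induction n generalizing i with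
  | zero => rfl
  | succ n ih =>
    simp only [deriv]
    split
    · rw [ih, hδ]
    · rw [ih, map_zero]

/-- The structure morphism `O_* → R_*`. -/
noncomputable def baseHom : Hom (base π) R where
  app n := Algebra.ofId O (R.ring n)
  app_u n x := ((R.u n).commutes x).symm
  app_δ n x := (R.δ_algebraMap n x).symm

/-- The prolongation `(u_n, δ_n)` as a morphism `R_n → W_1(R_{n+1})`. -/
noncomputable def toWitt (n : ℕ) : R.ring n →ₐ[O] PiWitt π 1 (R.ring (n + 1)) :=
  PiWitt.ofPiDerivation (R.u n) (R.δ n) (R.isPiDerivation n) (R.δ_algebraMap n)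

lemma toWitt_coeff_zero (n : ℕ) (x : R.ring n) : (R.toWitt n x).coeff 0 = R.u n x := rfl

lemma toWitt_coeff_one (n : ℕ) (x : R.ring n) : (R.toWitt n x).coeff 1 = R.δ n x := rfl

/-- A prolongation sequence from morphisms `C_n → W_1(C_{n+1})`. -/
noncomputable abbrev ofWitt (C : ℕ → Type u) [∀ n, CommRing (C n)] [∀ n, Algebra O (C n)]
    (d : ∀ n, C n →ₐ[O] PiWitt π 1 (C (n + 1)))
    (h : ∀ n, (PiWitt.map 1 ((PiWitt.coeffZero 1).comp (d (n + 1)))).comp (d n) =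
      (d (n + 1)).comp ((PiWitt.coeffZero 1).comp (d n))) :
    ProlongationSequence.{v, u} π where
  ring := C
  u n := (PiWitt.coeffZero 1).comp (d n)
  δ n x := (d n x).coeff 1
  isPiDerivation n := PiWitt.isPiDerivation _ _ fun _ => rfl
  u_δ n x := congrArg (fun z => z.coeff 1) (DFunLike.congr_fun (h n) x)
  δ_algebraMap n c := PiWitt.coeff_one_algebraMap (d n) c

section Poly

variable (Γ : Type t)

/-- The polynomial ring `R_n[x, x^(1), …, x^(n)]`, where `x = (x_γ)`; the variable `x_γ^(i)` is
`X (γ, i)`. -/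
abbrev PolyRing (n : ℕ) : Type (max t w) := MvPolynomial (Γ × Fin (n + 1)) (R.ring n)

/-- The prolongation `a ↦ (u_n a, δ_n a)` on polynomial rings, as a morphism of `O`-algebras to
`W_1`: it extends the prolongation of `R_n` and maps `x_γ^(i)` to `(x_γ^(i), x_γ^(i+1))`. -/
noncomputable def polyWitt (n : ℕ) :
    R.PolyRing Γ n →ₐ[O] PiWitt π 1 (R.PolyRing Γ (n + 1)) where
  __ := MvPolynomial.eval₂Hom
    ((PiWitt.map 1 (IsScalarTower.toAlgHom O (R.ring (n + 1)) (R.PolyRing Γ (n + 1)))).comp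
      (R.toWitt n)).toRingHom
    (fun s => PiWitt.mk₁ π (MvPolynomial.X (s.1, s.2.castSucc)) (MvPolynomial.X (s.1, s.2.succ)))
  commutes' c := by
    simp [IsScalarTower.algebraMap_apply O (R.ring n) (R.PolyRing Γ n), MvPolynomial.algebraMap_eq]

lemma polyWitt_X (n : ℕ) (s : Γ × Fin (n + 1)) : R.polyWitt Γ n (MvPolynomial.X s) =
    PiWitt.mk₁ π (MvPolynomial.X (s.1, s.2.castSucc)) (MvPolynomial.X (s.1, s.2.succ)) := by
  simp [polyWitt]

lemma polyWitt_C (n : ℕ) (r : R.ring n) : R.polyWitt Γ n (MvPolynomial.C r) =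
    PiWitt.mk₁ π (MvPolynomial.C (R.u n r)) (MvPolynomial.C (R.δ n r)) := by
  refine PiWitt.ext₁ ?_ ?_ <;> simp [polyWitt] <;> rfl


variable {R Γ} in
lemma polyHom_ext {n : ℕ} {D : Type*} [CommRing D] [Algebra O D] {f g : R.PolyRing Γ n →ₐ[O] D}
    (hC : ∀ r, f (MvPolynomial.C r) = g (MvPolynomial.C r))
    (hX : ∀ s, f (MvPolynomial.X s) = g (MvPolynomial.X s)) : f = g :=
  AlgHom.coe_ringHom_injective (MvPolynomial.ringHom_ext hC hX)

/-- The prolongation sequence `R_0[x] ⇉ R_1[x, x^(1)] ⇉ R_2[x, x^(1), x^(2)] ⇉ ⋯` in which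
`u_n` and `δ_n` extend those of `R_*`, `u_n x_γ^(i) = x_γ^(i)` and `δ_n x_γ^(i) = x_γ^(i+1)`. -/
noncomputable abbrev polySeq : ProlongationSequence.{v, max t w} π :=
  ofWitt (R.PolyRing Γ) (R.polyWitt Γ) fun n => by
    refine polyHom_ext (fun r => ?_) fun s => ?_
    · refine PiWitt.ext₁ ?_ ?_
      · simp [polyWitt_C, PiWitt.coeffZero, PiWitt.mk₁]
      · simp [polyWitt_C, PiWitt.coeffZero, PiWitt.mk₁, R.u_δ]
    · refine PiWitt.ext₁ ?_ ?_ <;> simp [polyWitt_X, PiWitt.coeffZero, PiWitt.mk₁]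

lemma polySeq_u_X (n : ℕ) (s : Γ × Fin (n + 1)) :
    (R.polySeq Γ).u n (MvPolynomial.X s) = MvPolynomial.X (s.1, s.2.castSucc) :=
  congrArg (fun z => z.coeff 0) (R.polyWitt_X Γ n s)

lemma polySeq_δ_X (n : ℕ) (s : Γ × Fin (n + 1)) :
    (R.polySeq Γ).δ n (MvPolynomial.X s) = MvPolynomial.X (s.1, s.2.succ) :=
  congrArg (fun z => z.coeff 1) (R.polyWitt_X Γ n s)

lemma polySeq_u_C (n : ℕ) (r : R.ring n) :
    (R.polySeq Γ).u n (MvPolynomial.C r) = MvPolynomial.C (R.u n r) :=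
  congrArg (fun z => z.coeff 0) (R.polyWitt_C Γ n r)

lemma polySeq_δ_C (n : ℕ) (r : R.ring n) :
    (R.polySeq Γ).δ n (MvPolynomial.C r) = MvPolynomial.C (R.δ n r) :=
  congrArg (fun z => z.coeff 1) (R.polyWitt_C Γ n r)

/-- The structure morphism `R_* → R_*[x, x^(1), …]`. -/
noncomputable def polyIncl : Hom R (R.polySeq Γ) where
  app n := IsScalarTower.toAlgHom O (R.ring n) (R.PolyRing Γ n)
  app_u n r := (R.polySeq_u_C Γ n r).symm
  app_δ n r := (R.polySeq_δ_C Γ n r).symm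

variable {R Γ} {C : ProlongationSequence.{v, u} π}

/-- The evaluation `R_n[x, …, x^(n)] → C_n` with `x_γ^(i) ↦ δ ^ i (c_γ)`, where `c_γ ∈ C_0` and
`C_*` is a prolongation sequence over `R_*`. -/
noncomputable def polyEval {C : ProlongationSequence.{v, u} π} (h : Hom R C) (c : Γ → C.ring 0)
    (n : ℕ) : R.PolyRing Γ n →ₐ[O] C.ring n where
  __ := MvPolynomial.eval₂Hom (h.app n).toRingHom (fun s => C.deriv n (c s.1) s.2)
  commutes' r := by
    simp [IsScalarTower.algebraMap_apply O (R.ring n) (R.PolyRing Γ n), MvPolynomial.algebraMap_eq]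

lemma polyEval_X (h : Hom R C) (c : Γ → C.ring 0) (n : ℕ) (s : Γ × Fin (n + 1)) :
    polyEval h c n (MvPolynomial.X s) = C.deriv n (c s.1) s.2 := by
  simp [polyEval]

lemma polyEval_C (h : Hom R C) (c : Γ → C.ring 0) (n : ℕ) (r : R.ring n) :
    polyEval h c n (MvPolynomial.C r) = h.app n r := by
  simp [polyEval]

lemma polyEval_witt (h : Hom R C) (c : Γ → C.ring 0) (n : ℕ) :
    (PiWitt.map 1 (polyEval h c (n + 1))).comp (R.polyWitt Γ n) =
      (C.toWitt n).comp (polyEval h c n) := by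
  refine polyHom_ext (fun r => ?_) fun s => ?_
  · refine PiWitt.ext₁ ?_ ?_
    · simp [polyWitt_C, PiWitt.mk₁, polyEval_C, toWitt_coeff_zero, h.app_u]
    · simp [polyWitt_C, PiWitt.mk₁, polyEval_C, toWitt_coeff_one, h.app_δ]
  · have hs : (s.2 : ℕ) ≤ n := Nat.lt_succ_iff.1 s.2.2
    refine PiWitt.ext₁ ?_ ?_
    · simp [polyWitt_X, PiWitt.mk₁, polyEval_X, toWitt_coeff_zero, u_deriv hs]
    · simp [polyWitt_X, PiWitt.mk₁, polyEval_X, toWitt_coeff_one, δ_deriv hs]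

/-- The evaluations form a morphism of prolongation sequences. -/
noncomputable def polyLift (h : Hom R C) (c : Γ → C.ring 0) : Hom (R.polySeq Γ) C where
  app := polyEval h c
  app_u n x := congrArg (fun z => z.coeff 0) (DFunLike.congr_fun (polyEval_witt h c n) x)
  app_δ n x := congrArg (fun z => z.coeff 1) (DFunLike.congr_fun (polyEval_witt h c n) x)

lemma polyEval_deriv (h : Hom R C) (c : Γ → C.ring 0) (n i : ℕ) (x : R.PolyRing Γ 0) :
    polyEval h c n ((R.polySeq Γ).deriv n x i) = C.deriv n (polyEval h c 0 x) i :=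
  (polyLift h c).app_deriv n i x

end Poly

section Frobenius

variable {R}

lemma deltaFrob_aux (n : ℕ) (x y : R.ring n) :
    R.u n (x + y) ^ q π + algebraMap O _ π * R.δ n (x + y) =
      (R.u n x ^ q π + algebraMap O _ π * R.δ n x) +
        (R.u n y ^ q π + algebraMap O _ π * R.δ n y) := by
  rw [(R.isPiDerivation n).add, mul_add, mul_add, cVal_spec, map_add]
  ring

variable (R)

/-- The morphism `φ_n : R_n → R_{n+1}`, `a ↦ u_n(a) ^ q + π δ_n(a)`. -/
noncomputable def φ (n : ℕ) : R.ring n →ₐ[O] R.ring (n + 1) where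
  toFun x := R.u n x ^ q π + algebraMap O _ π * R.δ n x
  map_zero' := by
    have := deltaFrob_aux n (0 : R.ring n) 0
    rw [add_zero] at this
    exact left_eq_add.1 this
  map_one' := by
    have := R.δ_algebraMap n 1
    rw [map_one] at this
    rw [this, ← map_mul, baseDelta_spec]
    simp
  map_add' := deltaFrob_aux n
  map_mul' x y := by
    rw [(R.isPiDerivation n).mul, map_mul]
    ring
  commutes' c := by
    rw [R.δ_algebraMap, ← map_mul, baseDelta_spec, AlgHom.commutes, map_sub, map_pow]
    ring

lemma φ_apply (n : ℕ) (x : R.ring n) :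
    R.φ n x = R.u n x ^ q π + algebraMap O _ π * R.δ n x := rfl

lemma φ_u (n : ℕ) (x : R.ring n) : R.φ (n + 1) (R.u n x) = R.u (n + 1) (R.φ n x) := by
  simp [φ_apply, ← R.u_δ]

/-- For `i ≤ n`, the image in `R_n` of `φ ^ i c ∈ R_i`, where `c ∈ R_0`. -/
noncomputable def frob : ∀ n : ℕ, R.ring 0 → ℕ → R.ring n
  | 0, c, _ => c
  | n + 1, c, i => if i = n + 1 then R.φ n (frob n c n) else R.u n (frob n c i)

variable {R}

lemma u_frob {n i : ℕ} (h : i ≤ n) (c : R.ring 0) :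
    R.u n (R.frob n c i) = R.frob (n + 1) c i := by
  rw [frob, if_neg (by omega)]

lemma φ_frob {n i : ℕ} (h : i ≤ n) (c : R.ring 0) :
    R.φ n (R.frob n c i) = R.frob (n + 1) c (i + 1) := by
  induction n with
  | zero =>
    obtain rfl : i = 0 := by omega
    simp [frob]
  | succ n ih =>
    rcases Nat.lt_or_ge i (n + 1) with h' | h'
    · rw [← u_frob (by omega), φ_u, ih (by omega), u_frob (by omega)]
    · obtain rfl : i = n + 1 := by omega
      conv_rhs => rw [frob, if_pos rfl]

lemma Hom.app_frob {S : ProlongationSequence.{v, u} π} (f : Hom R S) (n i : ℕ) (c : R.ring 0) :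
    f.app n (R.frob n c i) = S.frob n (f.app 0 c) i := by
  induction n generalizing i with
  | zero => rfl
  | succ n ih =>
    simp only [frob]
    split
    · rw [φ_apply, φ_apply, map_add, map_mul, map_pow, f.app_δ, f.app_u, ih, AlgHom.commutes]
    · rw [f.app_u, ih]

lemma frob_add (n i : ℕ) (c d : R.ring 0) :
    R.frob n (c + d) i = R.frob n c i + R.frob n d i := by
  induction n generalizing i with
  | zero => rfl
  | succ n ih => simp only [frob]; split <;> simp [ih]

lemma frob_mul (n i : ℕ) (c d : R.ring 0) :
    R.frob n (c * d) i = R.frob n c i * R.frob n d i := by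
  induction n generalizing i with
  | zero => rfl
  | succ n ih => simp only [frob]; split <;> simp [ih]

lemma frob_algebraMap (n i : ℕ) (c : O) :
    R.frob n (algebraMap O _ c) i = algebraMap O _ c := by
  induction n generalizing i with
  | zero => rfl
  | succ n ih => simp only [frob]; split <;> simp [ih]

end Frobenius

section Exp

/-- A lift of Frobenius on `O[T, …, T^(n)]` with `T^(i) ↦ (T^(i)) ^ q + π T^(i+1)` for `i < n`. -/
noncomputable def truncFrob (π : O) [Fact (Prime π)] [Finite (O ⧸ Ideal.span {π})] (n : ℕ) :
    (base π).PolyRing PUnit.{1} n →ₐ[O] (base π).PolyRing PUnit.{1} n :=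
  MvPolynomial.aeval (R := O) fun s => MvPolynomial.X s ^ q π +
    algebraMap O _ π * if h : (s.2 : ℕ) < n then
      MvPolynomial.X (s.1, (⟨s.2 + 1, Nat.succ_lt_succ h⟩ : Fin (n + 1))) else 0

lemma truncFrob_spec (n : ℕ) (f : (base π).PolyRing PUnit.{1} n) :
    algebraMap O ((base π).PolyRing PUnit.{1} n) π ∣ truncFrob π n f - f ^ q π :=
  mvPolynomial_frobenius π _ (fun s => by
    rw [truncFrob, MvPolynomial.aeval_X, add_sub_cancel_left]
    exact dvd_mul_right _ _) f

lemma truncFrob_u (n : ℕ) :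
    (truncFrob π (n + 1)).comp (((base π).polySeq PUnit.{1}).u n) =
      ((base π).polySeq PUnit.{1}).φ n := by
  refine polyHom_ext (fun r => ?_) fun s => ?_
  · exact ((truncFrob π (n + 1)).comp (((base π).polySeq PUnit.{1}).u n)).commutes r |>.trans
      ((((base π).polySeq PUnit.{1}).φ n).commutes r).symm
  · rw [φ_apply, AlgHom.comp_apply, polySeq_u_X, polySeq_δ_X]
    have hs : (s.2.castSucc : ℕ) < n + 1 := s.2.2
    rw [truncFrob, MvPolynomial.aeval_X, dif_pos hs]
    rfl

lemma exists_expPoly (n : ℕ) : ∃ z : ℕ → (base π).PolyRing PUnit.{1} n, ∀ i ≤ n,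
    wittPoly π z i =
      ((base π).polySeq PUnit.{1}).frob n (MvPolynomial.X (PUnit.unit, (0 : Fin 1))) i := by
  refine exists_wittPoly_eq (truncFrob π n) (truncFrob_spec n) _ n fun i hi => ?_
  obtain ⟨m, rfl⟩ : ∃ m, n = m + 1 := ⟨n - 1, by omega⟩
  rw [← u_frob (n := m) (i := i) (by omega), ← φ_frob (n := m) (by omega), ← truncFrob_u,
    AlgHom.comp_apply, sub_self]
  exact dvd_zero _

/-- The polynomials `P_k ∈ O[T, …, T^(k)] ⊆ O[T, …, T^(n)]`, for `0 ≤ k ≤ n`: they are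
characterized by `w_i(P_0, …, P_i) = φ ^ i (T)` for `0 ≤ i ≤ n`, where
`φ (T^(j)) = (T^(j)) ^ q + π T^(j+1)`. -/
noncomputable def expPoly (π : O) [Fact (Prime π)] [Finite (O ⧸ Ideal.span {π})] (n : ℕ) : PiWitt π n ((base π).PolyRing PUnit.{1} n) :=
  PiWitt.ofSeq π n (exists_expPoly n).choose

lemma ghost_expPoly {n i : ℕ} (h : i ≤ n) : (expPoly π n).ghost i =
    ((base π).polySeq PUnit.{1}).frob n (MvPolynomial.X (PUnit.unit, (0 : Fin 1))) i :=
  (PiWitt.ghost_ofSeq _ h).trans ((exists_expPoly n).choose_spec i h)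

/-- The map `c ↦ (P_0(c), …, P_n(c))`, with `P_k(c) = P_k(c, δ c, …, δ ^ k c) ∈ R_n`. -/
noncomputable def expFun (n : ℕ) (c : R.ring 0) : PiWitt π n (R.ring n) :=
  PiWitt.map n (polyEval R.baseHom (fun _ : PUnit.{1} => c) n) (expPoly π n)

variable {R}

lemma ghost_expFun {n i : ℕ} (h : i ≤ n) (c : R.ring 0) :
    (R.expFun n c).ghost i = R.frob n c i := by
  rw [expFun, PiWitt.ghost_map, ghost_expPoly h]
  have := (polyLift R.baseHom (fun _ : PUnit.{1} => c)).app_frob n i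
    (MvPolynomial.X (PUnit.unit, (0 : Fin 1)))
  refine this.trans ?_
  congr 1
  exact polyEval_X _ _ _ _

lemma map_expFun {S : ProlongationSequence.{v, u} π} (f : Hom R S) (n : ℕ) (c : R.ring 0) :
    PiWitt.map n (f.app n) (R.expFun n c) = S.expFun n (f.app 0 c) := by
  have : (f.app n).comp (polyEval R.baseHom (fun _ : PUnit.{1} => c) n) =
      polyEval S.baseHom (fun _ : PUnit.{1} => f.app 0 c) n := by
    refine polyHom_ext (fun r => ?_) fun s => ?_
    · rw [AlgHom.comp_apply, polyEval_C, polyEval_C]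
      exact (f.app n).commutes r
    · rw [AlgHom.comp_apply, polyEval_X, polyEval_X, f.app_deriv]
  rw [expFun, expFun, ← this]
  rfl

variable (R)

/-- The canonical morphism of prolongation sequences from `O_*[x_c, x_c^(1), …]`, `c ∈ R_0`, to
`R_*`. -/
noncomputable abbrev presHom : Hom ((base π).polySeq (R.ring 0)) R := polyLift R.baseHom _root_.id

lemma presHom_surj (c : R.ring 0) : R.presHom.app 0 (MvPolynomial.X (c, (0 : Fin 1))) = c :=
  polyEval_X _ _ _ _


lemma expFun_add (n : ℕ) (c d : R.ring 0) : R.expFun n (c + d) = R.expFun n c + R.expFun n d := by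
  rw [← R.presHom_surj c, ← R.presHom_surj d, ← map_add, ← map_expFun, ← map_expFun,
    ← map_expFun, ← map_add]
  refine congrArg _ (PiWitt.mvExt fun i hi => ?_)
  rw [PiWitt.ghost_add _ _ hi]
  exact ((ghost_expFun hi _).trans (frob_add n i _ _)).trans
    (congrArg₂ (· + ·) (ghost_expFun hi _).symm (ghost_expFun hi _).symm)

lemma expFun_mul (n : ℕ) (c d : R.ring 0) : R.expFun n (c * d) = R.expFun n c * R.expFun n d := by
  rw [← R.presHom_surj c, ← R.presHom_surj d, ← map_mul, ← map_expFun, ← map_expFun,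
    ← map_expFun, ← map_mul]
  refine congrArg _ (PiWitt.mvExt fun i hi => ?_)
  rw [PiWitt.ghost_mul _ _ hi]
  exact ((ghost_expFun hi _).trans (frob_mul n i _ _)).trans
    (congrArg₂ (· * ·) (ghost_expFun hi _).symm (ghost_expFun hi _).symm)

lemma expFun_algebraMap (n : ℕ) (c : O) :
    R.expFun n (algebraMap O _ c) = algebraMap O _ c := by
  have h : (base π).expFun n c = PiWitt.const π n O c :=
    PiWitt.ext_ghost PiWitt.base_torsionFree fun i hi =>
      ((ghost_expFun hi _).trans (frob_algebraMap n i c)).trans (PiWitt.ghost_const c hi).symm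
  have h2 := map_expFun R.baseHom n c
  rw [h] at h2
  exact h2.symm.trans ((PiWitt.map n (R.baseHom.app n)).commutes c)

/-- The canonical morphism of `O`-algebras `R_0 → W_n(R_n)`, `c ↦ (P_0(c), …, P_n(c))`. -/
noncomputable def exp (n : ℕ) : R.ring 0 →ₐ[O] PiWitt π n (R.ring n) where
  toFun := R.expFun n
  map_zero' := by simpa using R.expFun_algebraMap n 0
  map_one' := by simpa using R.expFun_algebraMap n 1
  map_add' := R.expFun_add n
  map_mul' := R.expFun_mul n
  commutes' := R.expFun_algebraMap n

end Exp

section Jet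

variable {ι : Type t} {σ : Type u}

/-- The inclusion `R_0[x] = R_0[x^(0)]` of polynomials in degree zero. -/
noncomputable def polyZero (ι : Type t) : MvPolynomial ι (R.ring 0) →ₐ[R.ring 0] R.PolyRing ι 0 :=
  MvPolynomial.rename fun i => (i, 0)

/-- The ideal `(f, δ f, …, δ ^ n f)` of `R_n[x, x^(1), …, x^(n)]`, for a family
`f = (f_j)` of polynomials in `R_0[x]`. -/
noncomputable def jetIdeal (f : σ → MvPolynomial ι (R.ring 0)) (n : ℕ) : Ideal (R.PolyRing ι n) :=
  Ideal.span {g | ∃ j, ∃ i ≤ n, g = (R.polySeq ι).deriv n (R.polyZero ι (f j)) i}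

/-- The `π`-jet algebra `R_n[x, x^(1), …, x^(n)] / (f, δ f, …, δ ^ n f)`. -/
abbrev Jet (f : σ → MvPolynomial ι (R.ring 0)) (n : ℕ) : Type (max t w) :=
  R.PolyRing ι n ⧸ R.jetIdeal f n

variable (f : σ → MvPolynomial ι (R.ring 0))

/-- The projection to the `π`-jet algebra. -/
noncomputable abbrev jetMk (n : ℕ) : R.PolyRing ι n →ₐ[O] R.Jet f n :=
  Ideal.Quotient.mkₐ O (R.jetIdeal f n)

lemma jetMk_deriv {n i : ℕ} (h : i ≤ n) (j : σ) :
    R.jetMk f n ((R.polySeq ι).deriv n (R.polyZero ι (f j)) i) = 0 :=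
  Ideal.Quotient.eq_zero_iff_mem.2 (Ideal.subset_span ⟨j, i, h, rfl⟩)

/-- The prolongation on `π`-jet algebras induced by the one on polynomial rings. -/
noncomputable def jetWitt (n : ℕ) : R.Jet f n →ₐ[O] PiWitt π 1 (R.Jet f (n + 1)) :=
  Ideal.Quotient.liftₐ (R.jetIdeal f n)
    ((PiWitt.map 1 (R.jetMk f (n + 1))).comp (R.polyWitt ι n)) (by
      suffices R.jetIdeal f n ≤
          RingHom.ker ((PiWitt.map 1 (R.jetMk f (n + 1))).comp (R.polyWitt ι n)) from
        fun a ha => this ha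
      refine Ideal.span_le.2 ?_
      rintro _ ⟨j, i, h, rfl⟩
      refine RingHom.mem_ker.2 (PiWitt.ext₁ ?_ ?_)
      · refine (congrArg (R.jetMk f (n + 1)) (u_deriv (R := R.polySeq ι) h _)).trans ?_
        rw [jetMk_deriv _ _ (by omega)]
        exact (map_zero (PiWitt.coeffZero (π := π) 1)).symm
      · refine (congrArg (R.jetMk f (n + 1)) (δ_deriv (R := R.polySeq ι) h _)).trans ?_
        rw [jetMk_deriv _ _ (by omega)]
        exact PiWitt.coeff_one_zero.symm)

lemma jetWitt_mk (n : ℕ) (x : R.PolyRing ι n) :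
    R.jetWitt f n (R.jetMk f n x) = PiWitt.map 1 (R.jetMk f (n + 1)) (R.polyWitt ι n x) := rfl

/-- The canonical prolongation sequence of `π`-jet algebras. -/
noncomputable abbrev jetSeq : ProlongationSequence.{v, max t w} π :=
  ofWitt (R.Jet f) (R.jetWitt f) fun n => by
    refine AlgHom.ext fun y => ?_
    obtain ⟨x, rfl⟩ := Ideal.Quotient.mk_surjective y
    refine PiWitt.ext₁ ?_ ?_
    · rfl
    · exact congrArg (R.jetMk f (n + 2)) ((R.polySeq ι).u_δ n x)

/-- The projection from the prolongation sequence of polynomial rings. -/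
noncomputable def jetProj : Hom (R.polySeq ι) (R.jetSeq f) where
  app := R.jetMk f
  app_u n x := rfl
  app_δ n x := rfl

/-- The structure morphism `R_* → J_* A`. -/
noncomputable def jetIncl : Hom R (R.jetSeq f) where
  app n := IsScalarTower.toAlgHom O (R.ring n) (R.Jet f n)
  app_u n r := congrArg (R.jetMk f (n + 1)) (R.polySeq_u_C ι n r).symm
  app_δ n r := congrArg (R.jetMk f (n + 1)) (R.polySeq_δ_C ι n r).symm

end Jet

section Functor

variable {R}
variable {A : Type u} [CommRing A] [Algebra (R.ring 0) A] {ι σ : Type u}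
variable {A' : Type u} [CommRing A'] [Algebra (R.ring 0) A'] {ι' σ' : Type u}

lemma jetMk_polyZero_eq (P : Algebra.Presentation (R.ring 0) A ι σ)
    {p p' : MvPolynomial ι (R.ring 0)}
    (h : MvPolynomial.aeval P.val p = MvPolynomial.aeval P.val p') :
    R.jetMk P.relation 0 (R.polyZero ι p) = R.jetMk P.relation 0 (R.polyZero ι p') := by
  have hle : P.ker ≤ RingHom.ker ((R.jetMk P.relation 0).toRingHom.comp
      (R.polyZero ι).toRingHom) := by
    rw [← P.span_range_relation_eq_ker]
    refine Ideal.span_le.2 ?_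
    rintro _ ⟨j, rfl⟩
    exact R.jetMk_deriv P.relation le_rfl j
  have hp : p - p' ∈ P.ker := by
    rw [P.ker_eq_ker_aeval_val, RingHom.mem_ker, map_sub, h, sub_self]
  have := hle hp
  rw [RingHom.mem_ker, map_sub, sub_eq_zero] at this
  exact this

/-- The canonical morphism `A → J_0 A = R_0[x] / (f)`, for an `R_0`-algebra `A` with a
presentation. -/
noncomputable def jetZero (P : Algebra.Presentation (R.ring 0) A ι σ) :
    A →ₐ[R.ring 0] R.Jet P.relation 0 where
  toFun a := R.jetMk P.relation 0 (R.polyZero ι (P.σ a))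
  map_zero' := (jetMk_polyZero_eq P (p' := 0) (by simp)).trans (by simp)
  map_one' := (jetMk_polyZero_eq P (p' := 1) (by simp)).trans (by simp)
  map_add' a b := (jetMk_polyZero_eq P (p' := P.σ a + P.σ b) (by simp)).trans (by simp)
  map_mul' a b := (jetMk_polyZero_eq P (p' := P.σ a * P.σ b) (by simp)).trans (by simp)
  commutes' r := (jetMk_polyZero_eq P (p' := MvPolynomial.C r) (by simp)).trans
    (congrArg (R.jetMk P.relation 0) ((R.polyZero ι).commutes r))

/-- The evaluation `R_n[x, …, x^(n)] → J_n A'` with `x_γ^(i) ↦ δ ^ i (g x_γ)`, where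
`g : A → A'` is a morphism of `R_0`-algebras. -/
noncomputable def jetEval (P : Algebra.Presentation (R.ring 0) A ι σ)
    (P' : Algebra.Presentation (R.ring 0) A' ι' σ') (g : A →ₐ[R.ring 0] A') (n : ℕ) :
    R.PolyRing ι n →ₐ[R.ring n] R.Jet P'.relation n :=
  MvPolynomial.aeval fun s => (R.jetSeq P'.relation).deriv n (jetZero P' (g (P.val s.1))) s.2

lemma jetEval_polyZero (P : Algebra.Presentation (R.ring 0) A ι σ)
    (P' : Algebra.Presentation (R.ring 0) A' ι' σ') (g : A →ₐ[R.ring 0] A')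
    (p : MvPolynomial ι (R.ring 0)) :
    jetEval P P' g 0 (R.polyZero ι p) = jetZero P' (g (MvPolynomial.aeval P.val p)) := by
  have : (jetEval P P' g 0).comp (R.polyZero ι) =
      ((jetZero P').comp g).comp (MvPolynomial.aeval P.val) := by
    refine MvPolynomial.algHom_ext fun γ => ?_
    simp only [AlgHom.comp_apply, MvPolynomial.aeval_X, polyZero, MvPolynomial.rename_X, jetEval]
    rfl
  exact DFunLike.congr_fun this p

lemma jetEval_eq (P : Algebra.Presentation (R.ring 0) A ι σ)
    (P' : Algebra.Presentation (R.ring 0) A' ι' σ') (g : A →ₐ[R.ring 0] A') (n : ℕ)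
    (p : R.PolyRing ι n) : jetEval P P' g n p =
      polyEval (R.jetIncl P'.relation) (fun γ => jetZero P' (g (P.val γ))) n p := by
  induction p using MvPolynomial.induction_on with
  | C r => rw [polyEval_C]; exact (jetEval P P' g n).commutes r
  | add a b ha hb => rw [map_add, map_add, ha, hb]
  | mul_X a s ha => rw [map_mul, map_mul, ha, polyEval_X, jetEval, MvPolynomial.aeval_X]

lemma jetEval_eq_zero (P : Algebra.Presentation (R.ring 0) A ι σ)
    (P' : Algebra.Presentation (R.ring 0) A' ι' σ') (g : A →ₐ[R.ring 0] A') (n : ℕ) :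
    ∀ p ∈ R.jetIdeal P.relation n, jetEval P P' g n p = 0 := by
  suffices R.jetIdeal P.relation n ≤ RingHom.ker (jetEval P P' g n) from fun a ha => this ha
  refine Ideal.span_le.2 ?_
  rintro _ ⟨j, i, h, rfl⟩
  have h0 : polyEval (R.jetIncl P'.relation) (fun γ => jetZero P' (g (P.val γ))) 0
      (R.polyZero ι (P.relation j)) = 0 := by
    rw [← jetEval_eq, jetEval_polyZero, P.aeval_val_relation, map_zero, map_zero]
  have h1 := polyEval_deriv (R.jetIncl P'.relation) (fun γ => jetZero P' (g (P.val γ))) n i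
    (R.polyZero ι (P.relation j))
  rw [h0] at h1
  exact (jetEval_eq P P' g n _).trans (h1.trans (deriv_zero (R.jetSeq P'.relation) n i))

/-- The morphism `J_n g : J_n A → J_n A'` induced by a morphism `g : A → A'` of `R_0`-algebras:
it maps the class of `x_γ^(i)` to `δ ^ i (g x_γ)`. -/
noncomputable def jetMap (P : Algebra.Presentation (R.ring 0) A ι σ)
    (P' : Algebra.Presentation (R.ring 0) A' ι' σ') (g : A →ₐ[R.ring 0] A') (n : ℕ) :
    R.Jet P.relation n →ₐ[R.ring n] R.Jet P'.relation n :=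
  Ideal.Quotient.liftₐ (R.jetIdeal P.relation n) (jetEval P P' g n) (jetEval_eq_zero P P' g n)

end Functor

section WittFunctor

/-- The `O`-algebra structure on an `R_n`-algebra. -/
noncomputable abbrev algebraBase (n : ℕ) (B : Type u) [CommRing B] [Algebra (R.ring n) B] :
    Algebra O B :=
  Algebra.compHom B (algebraMap O (R.ring n))

/-- The ring `W_n(B)` of an `R_n`-algebra `B`. -/
def WittAlg (n : ℕ) (B : Type u) [CommRing B] [Algebra (R.ring n) B] : Type u := PiWitt π n B

variable {n : ℕ} {B : Type u} [CommRing B] [Algebra (R.ring n) B]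
  {B' : Type u} [CommRing B'] [Algebra (R.ring n) B']

noncomputable instance : CommRing (R.WittAlg n B) :=
  letI := R.algebraBase n B
  inferInstanceAs (CommRing (PiWitt π n B))

/-- The `R_0`-algebra structure `R_0 → W_n(R_n) → W_n(B)` on `W_n(B)`, for an `R_n`-algebra `B`. -/
noncomputable instance : Algebra (R.ring 0) (R.WittAlg n B) :=
  letI := R.algebraBase n B
  ((PiWitt.map n ({ algebraMap (R.ring n) B with commutes' := fun _ => rfl } :
    R.ring n →ₐ[O] B)).comp (R.exp n)).toRingHom.toAlgebra

/-- The morphism of `R_0`-algebras `W_n(B) → W_n(B')` induced by a morphism of `R_n`-algebras. -/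
noncomputable def wittMap (f : B →ₐ[R.ring n] B') : R.WittAlg n B →ₐ[R.ring 0] R.WittAlg n B' :=
  letI := R.algebraBase n B
  letI := R.algebraBase n B'
  { (PiWitt.map n ({ f with commutes' := fun _ => f.commutes _ } : B →ₐ[O] B')).toRingHom with
    commutes' := fun c => PiWitt.ext (funext fun _ => f.commutes _) }

end WittFunctor

section JetSpaces

open CategoryTheory Opposite AlgebraicGeometry

variable (S : ProlongationSequence.{v, u} π) (n : ℕ)

/-- The functor `W_n` from `R_n`-algebras to `R_0`-algebras. -/
noncomputable def wittFunctor : CommAlgCat.{u} (S.ring n) ⥤ CommAlgCat.{u} (S.ring 0) where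
  obj B := CommAlgCat.of _ (S.WittAlg n B)
  map f := CommAlgCat.ofHom (S.wittMap f.hom)
  map_id _ := rfl
  map_comp _ _ := rfl

end JetSpaces
end ProlongationSequence

section Sites

open CategoryTheory Opposite AlgebraicGeometry

/-- The étale topology on the category of affine schemes over `Spec R`. An object is an
`R`-algebra `B`, standing for `Spec B`; the topology is generated by the jointly surjective families
of étale morphisms `Spec B_i → Spec B` over `Spec R`. -/
noncomputable def affineEtaleTopology (R : Type u) [CommRing R] :
    GrothendieckTopology (CommAlgCat.{u} R)ᵒᵖ :=
  (Scheme.etalePrecoverage.comap (algSpec (CommRingCat.of R) ⋙ Over.forget _)).toGrothendieck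

/-- The functor of points `B ↦ Hom_R(Spec B, X)` of a scheme `X` over `Spec R`, as a presheaf on
the category of affine schemes over `Spec R`. -/
noncomputable def points (R : Type u) [CommRing R] :
    Over (Spec (CommRingCat.of R)) ⥤ ((CommAlgCat.{u} R)ᵒᵖᵒᵖ ⥤ Type u) :=
  yoneda ⋙ (Functor.whiskeringLeft _ _ _).obj (algSpec (CommRingCat.of R)).op

/-- The `R`-algebra of global functions of a scheme over `Spec R`. -/
noncomputable abbrev functions {R : Type u} [CommRing R] (X : Over (Spec (CommRingCat.of R))) :
    CommAlgCat.{u} R := ((algΓ (CommRingCat.of R)).obj X).unop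

/-- The morphism on global functions induced by a morphism of schemes over `Spec R`. -/
noncomputable abbrev functionsMap {R : Type u} [CommRing R] {X Y : Over (Spec (CommRingCat.of R))}
    (f : X ⟶ Y) : functions Y →ₐ[R] functions X := ((algΓ (CommRingCat.of R)).map f).unop.hom

namespace ProlongationSequence

variable (R : ProlongationSequence.{v, u} π) [IsDomain O] (n : ℕ)

/-- Borger's jet functor `X ↦ J^n X`, with `(J^n X)(B) = X(W_n(B))` for every `R_n`-algebra `B`. -/
noncomputable def borgerJet : ((CommAlgCat.{u} (R.ring 0))ᵒᵖᵒᵖ ⥤ Type u) ⥤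
    ((CommAlgCat.{u} (R.ring n))ᵒᵖᵒᵖ ⥤ Type u) :=
  (Functor.whiskeringLeft _ _ _).obj (R.wittFunctor n).op.op

variable {X Y : Over (Spec (CommRingCat.of (R.ring 0)))} {ι σ ι' σ' : Type u}

/-- Buium's jet space `Spec (J_n A)` of the affine scheme `X = Spec A`, where `A = R_0[x] / (f)`. -/
noncomputable def buiumJet (P : Algebra.Presentation (R.ring 0) (functions X) ι σ) :
    Over (Spec (CommRingCat.of (R.ring n))) :=
  (algSpec (CommRingCat.of (R.ring n))).obj (op (CommAlgCat.of (R.ring n) (R.Jet P.relation n)))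

/-- The morphism `Spec (J_n A) → Spec (J_n B)` induced by a morphism `Spec A → Spec B`. -/
noncomputable def buiumJetMap (f : X ⟶ Y) (P : Algebra.Presentation (R.ring 0) (functions X) ι σ)
    (Q : Algebra.Presentation (R.ring 0) (functions Y) ι' σ') :
    R.buiumJet n P ⟶ R.buiumJet n Q :=
  (algSpec (CommRingCat.of (R.ring n))).map
    (CommAlgCat.ofHom (jetMap Q P (functionsMap f) n)).op

end ProlongationSequence

end Sites
end Prolongation
end PiJet

open PiJet CategoryTheory AlgebraicGeometry

/-!
Over a ring of polynomials over `O` the defining equation `w_i(P_0, …, P_i) = φ ^ i (T)` determines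
`P_k`, and the leading term of `φ ^ k (T)` is `π ^ k T^(k)`; hence `P_k` is `T^(k)` plus a polynomial
in `T, …, T^(k-1)` (`expPoly_coeff_sub_mem`). So over any `O`-algebra `B`, even one with
`π`-torsion, `v ↦ (P_0(v), …, P_n(v))` is a bijection from `B ^ (n + 1)` to `W_n(B)` that preserves
zero (`expMap_injective`, `expMap_surjective`, `expMap_eq_zero_iff`).

For a prolongation sequence `C_*` over `R_*` and a morphism of `R_n`-algebras `h : C_n → B`, the map
`C_0 → W_n(C_n) → W_n(B)` is a morphism of `R_0`-algebras, and it sends `c` to the Witt vector with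
`v_i = h (δ ^ i c)`. For `C_* = R_*[x, x', …]` the bijection above says that every morphism
`R_0[x] → W_n(B)` arises from exactly one `h`, with `h (x_γ^(i))` read off from the image of `x_γ`,
and that it kills a polynomial `f` if and only if `h` kills `f, δ f, …, δ ^ n f`. Passing to
quotients, `Hom_{R_n}(J_n A, B) = Hom_{R_0}(A, W_n(B))` (`jetWittEquiv`), naturally in `A` and `B`.

Translated to spectra, this is the isomorphism of functors `J^n X ≅ J^n_Bu X`. The right hand side
is the functor of points of an affine scheme, hence a sheaf, as the étale topology is subcanonical
(`isSheaf_points`).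
-/

namespace PiJet

/-! ### The coordinate change between Witt components and iterated derivatives -/

section ExpMap

open MvPolynomial ProlongationSequence

variable {O : Type v} [CommRing O] {π : O} [Fact (Prime π)] [Finite (O ⧸ Ideal.span {π})]
  [IsDomain O]

/-- Being a polynomial in given variables can be tested after multiplication by `π ^ k`, as `O` is a
domain. -/
lemma mem_supported_of_mul_mem {σ : Type*} {s : Set σ} {p : MvPolynomial σ O} (k : ℕ)
    (h : algebraMap O (MvPolynomial σ O) (π ^ k) * p ∈ supported O s) : p ∈ supported O s := by
  rw [mem_supported] at h ⊢
  rwa [MvPolynomial.algebraMap_eq,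
    vars_C_mul _ (pow_ne_zero k (Fact.out : Prime π).ne_zero)] at h

/-- The polynomials over `O` in those variables `T, …, T^(n)` whose order is less than `k`. -/
noncomputable abbrev lowerPoly (O : Type v) [CommRing O] (n k : ℕ) :
    Subalgebra O (MvPolynomial (PUnit.{1} × Fin (n + 1)) O) :=
  supported O {s | (s.2 : ℕ) < k}

lemma lowerPoly_mono {n k l : ℕ} (h : k ≤ l) : lowerPoly O n k ≤ lowerPoly O n l :=
  supported_mono fun _ hs => lt_of_lt_of_le hs h

lemma X_mem_lowerPoly {n k : ℕ} (i : Fin (n + 1)) (h : (i : ℕ) < k) :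
    (X (PUnit.unit, i) : MvPolynomial (PUnit.{1} × Fin (n + 1)) O) ∈ lowerPoly O n k :=
  Algebra.subset_adjoin ⟨_, h, rfl⟩

lemma truncFrob_X {n i : ℕ} (h : i < n) :
    truncFrob π n (X (PUnit.unit, (⟨i, by omega⟩ : Fin (n + 1)))) =
      X (PUnit.unit, (⟨i, by omega⟩ : Fin (n + 1))) ^ q π +
        algebraMap O _ π * X (PUnit.unit, (⟨i + 1, by omega⟩ : Fin (n + 1))) := by
  rw [truncFrob, aeval_X, dif_pos h]

lemma truncFrob_mem_lowerPoly {n k : ℕ} (h : k ≤ n)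
    {f : MvPolynomial (PUnit.{1} × Fin (n + 1)) O} (hf : f ∈ lowerPoly O n k) :
    truncFrob π n f ∈ lowerPoly O n (k + 1) := by
  suffices lowerPoly O n k ≤ (lowerPoly O n (k + 1)).comap (truncFrob π n) from this hf
  refine Algebra.adjoin_le ?_
  rintro _ ⟨⟨⟨⟩, i, hi⟩, hs, rfl⟩
  have hik : i < k := hs
  change truncFrob π n _ ∈ lowerPoly O n (k + 1)
  rw [truncFrob_X (by omega)]
  exact add_mem (pow_mem (X_mem_lowerPoly _ (Nat.lt_succ_of_lt hik)) _)
    (mul_mem (algebraMap_mem _ _) (X_mem_lowerPoly _ (Nat.succ_lt_succ hik)))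

lemma polySeq_deriv_X (R : ProlongationSequence.{v, w} π) {Γ : Type t} (γ : Γ) {n i : ℕ}
    (h : i ≤ n) : (R.polySeq Γ).deriv n (X (γ, (0 : Fin 1))) i =
      X (γ, (⟨i, by omega⟩ : Fin (n + 1))) := by
  induction n generalizing i with
  | zero =>
    obtain rfl : i = 0 := by omega
    rfl
  | succ n ih =>
    rcases Nat.lt_or_ge i (n + 1) with h' | h'
    · rw [← u_deriv (by omega), ih (by omega)]
      exact R.polySeq_u_X Γ n _
    · obtain rfl : i = n + 1 := by omega
      rw [← δ_deriv le_rfl, ih le_rfl]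
      exact R.polySeq_δ_X Γ n _

lemma frob_zero_index (R : ProlongationSequence.{v, w} π) (n : ℕ) (c : R.ring 0) :
    R.frob n c 0 = R.deriv n c 0 := by
  induction n with
  | zero => rfl
  | succ n ih => rw [← u_frob (Nat.zero_le n), ← u_deriv (Nat.zero_le n), ih]

lemma frob_X_succ {n i : ℕ} (h : i < n) :
    ((base π).polySeq PUnit.{1}).frob n (X (PUnit.unit, (0 : Fin 1))) (i + 1) =
      truncFrob π n (((base π).polySeq PUnit.{1}).frob n (X (PUnit.unit, (0 : Fin 1))) i) := by
  obtain ⟨m, rfl⟩ : ∃ m, n = m + 1 := ⟨n - 1, by omega⟩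
  rw [← u_frob (n := m) (i := i) (by omega), ← φ_frob (n := m) (by omega), ← truncFrob_u,
    AlgHom.comp_apply]

/-- The leading term of `φ ^ i (T)` is `π ^ i T^(i)`. -/
lemma frob_X_sub_mem {n i : ℕ} (h : i ≤ n) :
    (((base π).polySeq PUnit.{1}).frob n (X (PUnit.unit, (0 : Fin 1))) i :
      MvPolynomial (PUnit.{1} × Fin (n + 1)) O) -
      algebraMap O _ (π ^ i) * X (PUnit.unit, (⟨i, by omega⟩ : Fin (n + 1))) ∈
        lowerPoly O n i := by
  induction i with
  | zero =>
    rw [frob_zero_index, polySeq_deriv_X _ _ h]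
    simp
  | succ i ih =>
    have h1 := truncFrob_mem_lowerPoly (π := π) (by omega) (ih (by omega))
    rw [frob_X_succ (by omega)]
    rw [map_sub, map_mul, AlgHom.commutes, truncFrob_X (by omega)] at h1
    have h2 : algebraMap O (MvPolynomial (PUnit.{1} × Fin (n + 1)) O) (π ^ i) *
        X (PUnit.unit, (⟨i, by omega⟩ : Fin (n + 1))) ^ q π ∈ lowerPoly O n (i + 1) :=
      mul_mem (algebraMap_mem _ _) (pow_mem (X_mem_lowerPoly _ (Nat.lt_succ_self i)) _)
    convert add_mem h1 h2 using 1
    rw [pow_succ, map_mul]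
    ring

/-- The polynomial `P_k` is `T^(k)` up to a polynomial in `T, …, T^(k-1)`. -/
lemma expPoly_coeff_sub_mem (n k : ℕ) (hk : k < n + 1) :
    ((expPoly π n).coeff ⟨k, hk⟩ : MvPolynomial (PUnit.{1} × Fin (n + 1)) O) -
      X (PUnit.unit, (⟨k, hk⟩ : Fin (n + 1))) ∈ lowerPoly O n k := by
  induction k using Nat.strong_induction_on with
  | _ k ih =>
    have h1 := frob_X_sub_mem (π := π) (n := n) (i := k) (by omega)
    have h2 : ∑ j ∈ Finset.range k, algebraMap O (MvPolynomial (PUnit.{1} × Fin (n + 1)) O) (π ^ j) *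
        (expPoly π n).seq j ^ q π ^ (k - j) ∈ lowerPoly O n k := by
      refine sum_mem fun j hj => mul_mem (algebraMap_mem _ _) (pow_mem ?_ _)
      have hj' := Finset.mem_range.1 hj
      have hjn : j < n + 1 := by omega
      rw [show (expPoly π n).seq j = (expPoly π n).coeff ⟨j, hjn⟩ from
        PiWitt.seq_val (expPoly π n) ⟨j, hjn⟩]
      convert add_mem (lowerPoly_mono hj'.le (ih j hj' hjn))
        (X_mem_lowerPoly (O := O) (⟨j, hjn⟩ : Fin (n + 1)) hj') using 1
      ring
    rw [← ghost_expPoly (by omega), PiWitt.ghost, wittPoly_succ_eq,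
      show (expPoly π n).seq k = (expPoly π n).coeff ⟨k, hk⟩ from
        PiWitt.seq_val (expPoly π n) ⟨k, hk⟩] at h1
    -- `π ^ k (P_k - T^(k))` is `φ ^ k (T) - π ^ k T^(k)` minus the lower terms of `w_k(P)`.
    refine mem_supported_of_mul_mem (π := π) k ?_
    convert sub_mem h1 h2 using 1
    ring

variable {B : Type u} [CommRing B] [Algebra O B] {B' : Type w} [CommRing B'] [Algebra O B']

/-- The Witt vector `(P_0(v), …, P_n(v))`, where `P_k(v) = P_k(v_0, …, v_k)`. -/
noncomputable def expMap (π : O) [Fact (Prime π)] [Finite (O ⧸ Ideal.span {π})] (n : ℕ)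
    (v : Fin (n + 1) → B) : PiWitt π n B :=
  PiWitt.map n (aeval (R := O) fun s : PUnit.{1} × Fin (n + 1) => v s.2) (expPoly π n)

lemma map_expMap (f : B →ₐ[O] B') (n : ℕ) (v : Fin (n + 1) → B) :
    PiWitt.map n f (expMap π n v) = expMap π n fun i => f (v i) := by
  refine PiWitt.ext (funext fun k => ?_)
  exact comp_aeval_apply (fun s : PUnit.{1} × Fin (n + 1) => v s.2) f
    ((expPoly π n).coeff k)

lemma expFun_eq_expMap (C : ProlongationSequence.{v, u} π) (n : ℕ) (c : C.ring 0) :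
    C.expFun n c = expMap π n fun i => C.deriv n c i := by
  have : polyEval C.baseHom (fun _ : PUnit.{1} => c) n =
      aeval (R := O) fun s : PUnit.{1} × Fin (n + 1) => C.deriv n c s.2 :=
    MvPolynomial.algHom_ext fun s => by rw [polyEval_X, aeval_X]
  rw [expFun, this, expMap]

/-- The image of `exp c` under a morphism `C_n → B` depends only on the images of the iterated
derivatives of `c`. -/
lemma map_expFun_eq_expMap {C : ProlongationSequence.{v, u} π} {n : ℕ} (f : C.ring n →ₐ[O] B')
    (c : C.ring 0) : PiWitt.map n f (C.expFun n c) = expMap π n fun i => f (C.deriv n c i) := by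
  rw [expFun_eq_expMap, map_expMap]

lemma expMap_zero (n : ℕ) : expMap π n (0 : Fin (n + 1) → B) = 0 := by
  -- Over `O` this is `exp 0 = 0`; the general case follows by base change along `O → B`.
  have h := expFun_eq_expMap (base π) n 0
  simp only [ProlongationSequence.deriv_zero] at h
  have h0 : (base π).expFun n 0 = 0 := ((base π).exp n).map_zero
  have h1 := map_expMap (π := π) (Algebra.ofId O B) n 0
  simp only [Pi.zero_apply, map_zero] at h1
  refine h1.symm.trans ?_
  refine (congrArg (PiWitt.map n (Algebra.ofId O B)) (h.symm.trans h0)).trans ?_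
  exact map_zero _

/-- The coefficient `P_k(v)` is `v_k` up to a term depending on `v_0, …, v_(k-1)` only. -/
lemma expMap_coeff_sub_congr {n : ℕ} {v w : Fin (n + 1) → B} (k : Fin (n + 1))
    (h : ∀ j < k, v j = w j) :
    (expMap π n v).coeff k - v k = (expMap π n w).coeff k - w k := by
  have hk := mem_supported.1 (expPoly_coeff_sub_mem (π := π) n k k.2)
  have e (v : Fin (n + 1) → B) : (expMap π n v).coeff k - v k =
      aeval (R := O) (fun s : PUnit.{1} × Fin (n + 1) => v s.2)
        ((expPoly π n).coeff k - X (PUnit.unit, k)) := by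
    rw [map_sub, aeval_X]
    rfl
  rw [e, e]
  refine eval₂Hom_congr' rfl (fun s hs _ => ?_) rfl
  exact h s.2 (hk hs)

/-- The triangular system `P_k(v) = x_k` has at most one solution, over any `O`-algebra. -/
lemma expMap_injective (n : ℕ) : Function.Injective (expMap π n : (Fin (n + 1) → B) → _) := by
  intro v w h
  funext k
  induction k using WellFoundedLT.induction with
  | _ k ih =>
    have := expMap_coeff_sub_congr (π := π) k ih
    rwa [h, sub_right_inj] at this

/-- The triangular system `P_k(v) = x_k` has a solution, over any `O`-algebra. -/
lemma expMap_surjective (n : ℕ) : Function.Surjective (expMap π n : (Fin (n + 1) → B) → _) := by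
  intro x
  suffices ∀ m, ∃ v : Fin (n + 1) → B, ∀ k : Fin (n + 1), (k : ℕ) < m →
      (expMap π n v).coeff k = x.coeff k by
    obtain ⟨v, hv⟩ := this (n + 1)
    exact ⟨v, PiWitt.ext (funext fun k => hv k k.2)⟩
  intro m
  induction m with
  | zero => exact ⟨0, fun k hk => absurd hk (Nat.not_lt_zero _)⟩
  | succ m ih =>
    obtain ⟨v, hv⟩ := ih
    by_cases hm : m < n + 1
    · let i : Fin (n + 1) := ⟨m, hm⟩
      -- Changing `v_m` shifts `P_m(v)` by the same amount and leaves the earlier `P_k(v)` alone.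
      refine ⟨Function.update v i (v i + (x.coeff i - (expMap π n v).coeff i)), fun k hk => ?_⟩
      have hlow : ∀ j < k, Function.update v i (v i + (x.coeff i - (expMap π n v).coeff i)) j =
          v j := fun j hj => Function.update_of_ne
        (Fin.ne_of_lt (lt_of_lt_of_le hj (Nat.lt_succ_iff.1 hk))) _ _
      have h := expMap_coeff_sub_congr (π := π) k hlow
      rcases Nat.lt_succ_iff_lt_or_eq.1 hk with hk' | hk'
      · rw [Function.update_of_ne (Fin.ne_of_lt hk'), sub_left_inj] at h
        rw [h, hv k hk']
      · obtain rfl : k = i := Fin.ext hk'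
        rw [Function.update_self] at h
        linear_combination h
    · exact ⟨v, fun k _ => hv k (by omega)⟩

lemma expMap_eq_zero_iff {n : ℕ} {v : Fin (n + 1) → B} : expMap π n v = 0 ↔ v = 0 := by
  rw [← expMap_zero, (expMap_injective n).eq_iff]

end ExpMap

end PiJet

namespace PiJet

/-! ### The universal property of the jet algebra -/

namespace ProlongationSequence

variable {O : Type v} [CommRing O] {π : O} [Fact (Prime π)] [Finite (O ⧸ Ideal.span {π})]
  [IsDomain O] {R : ProlongationSequence.{v, w} π} {n : ℕ}

section RestrictBase

variable {C : Type t} [CommRing C] [Algebra (R.ring n) C] [Algebra O C]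
  [IsScalarTower O (R.ring n) C] {B : Type u} [CommRing B] [Algebra (R.ring n) B]

/-- A morphism of `R_n`-algebras as a morphism of `O`-algebras, for the `O`-algebra structure on
the target used by `WittAlg`. -/
noncomputable def restrictBase (h : C →ₐ[R.ring n] B) :
    letI := R.algebraBase n B
    C →ₐ[O] B :=
  letI := R.algebraBase n B
  { h with
    commutes' := fun c => by
      rw [IsScalarTower.algebraMap_apply O (R.ring n) C]
      exact h.commutes _ }

/-- The Witt vector `(P_0(v), …, P_n(v))` in `W_n(B)`, for an `R_n`-algebra `B`. -/
noncomputable def expWitt (R : ProlongationSequence.{v, w} π) (n : ℕ) {B : Type u} [CommRing B]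
    [Algebra (R.ring n) B] (v : Fin (n + 1) → B) : R.WittAlg n B :=
  letI := R.algebraBase n B
  expMap π n v

lemma expWitt_bijective :
    Function.Bijective (expWitt R n : (Fin (n + 1) → B) → R.WittAlg n B) :=
  letI := R.algebraBase n B
  ⟨expMap_injective n, expMap_surjective n⟩

lemma expWitt_eq_zero_iff {v : Fin (n + 1) → B} : expWitt R n v = 0 ↔ v = 0 :=
  letI := R.algebraBase n B
  expMap_eq_zero_iff

lemma wittMap_expWitt {B' : Type u} [CommRing B'] [Algebra (R.ring n) B'] (f : B →ₐ[R.ring n] B')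
    (v : Fin (n + 1) → B) : R.wittMap f (expWitt R n v) = expWitt R n fun i => f (v i) :=
  letI := R.algebraBase n B
  letI := R.algebraBase n B'
  map_expMap ({ f with commutes' := fun _ => f.commutes _ } : B →ₐ[O] B') n v

end RestrictBase

section Transfer

variable {C : ProlongationSequence.{v, t} π} [Algebra (R.ring n) (C.ring n)]
  [IsScalarTower O (R.ring n) (C.ring n)] {B : Type u} [CommRing B] [Algebra (R.ring n) B]

/-- The morphism `C_0 → W_n(C_n) → W_n(B)`, for a morphism of `R_n`-algebras `C_n → B`. -/
noncomputable def expComp (h : C.ring n →ₐ[R.ring n] B) : C.ring 0 →+* R.WittAlg n B :=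
  letI := R.algebraBase n B
  ((PiWitt.map n (restrictBase h)).comp (C.exp n)).toRingHom

lemma expComp_apply (h : C.ring n →ₐ[R.ring n] B) (c : C.ring 0) :
    expComp h c = expWitt R n fun i => h (C.deriv n c i) :=
  letI := R.algebraBase n B
  map_expFun_eq_expMap (restrictBase h) c

/-- `expComp` is compatible with the `R_0`-algebra structures, when `C_*` lies over `R_*`. -/
lemma expComp_hom (f : Hom R C) (hf : ∀ r, f.app n r = algebraMap (R.ring n) (C.ring n) r)
    (h : C.ring n →ₐ[R.ring n] B) (r : R.ring 0) :
    expComp h (f.app 0 r) = algebraMap (R.ring 0) (R.WittAlg n B) r := by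
  let := R.algebraBase n B
  refine (congrArg (PiWitt.map n (restrictBase h)) (map_expFun f n r).symm).trans ?_
  refine PiWitt.ext (funext fun k => ?_)
  exact (congrArg h (hf _)).trans (h.commutes _)

end Transfer

section Jet

variable {A : Type u} [CommRing A] [Algebra (R.ring 0) A] {ι σ : Type u}
  (P : Algebra.Presentation (R.ring 0) A ι σ)
  {B : Type u} [CommRing B] [Algebra (R.ring n) B]

lemma jetZero_val (γ : ι) :
    jetZero P (P.val γ) = R.jetMk P.relation 0 (MvPolynomial.X (γ, (0 : Fin 1))) :=
  (jetMk_polyZero_eq P (p' := MvPolynomial.X γ) (by simp)).trans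
    (congrArg _ (MvPolynomial.rename_X _ γ))

lemma jetSeq_deriv_jetMk (x : R.PolyRing ι 0) (i : ℕ) :
    (R.jetSeq P.relation).deriv n (R.jetMk P.relation 0 x) i =
      R.jetMk P.relation n ((R.polySeq ι).deriv n x i) :=
  ((R.jetProj P.relation).app_deriv n i x).symm

lemma jetSeq_deriv_val (s : ι × Fin (n + 1)) :
    (R.jetSeq P.relation).deriv n (jetZero P (P.val s.1)) s.2 =
      R.jetMk P.relation n (MvPolynomial.X s) := by
  rw [jetZero_val, jetSeq_deriv_jetMk, polySeq_deriv_X _ _ (Nat.lt_succ_iff.1 s.2.2)]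

/-- The morphism of `R_0`-algebras `A → J_0 A → W_n(J_n A) → W_n(B)` attached to a morphism of
`R_n`-algebras `J_n A → B`. -/
noncomputable def jetToWitt (h : R.Jet P.relation n →ₐ[R.ring n] B) :
    A →ₐ[R.ring 0] R.WittAlg n B :=
  { (expComp (C := R.jetSeq P.relation) h).comp (jetZero P).toRingHom with
    commutes' := fun r => (congrArg (expComp (C := R.jetSeq P.relation) h)
      ((jetZero P).commutes r)).trans
        (expComp_hom (R.jetIncl P.relation) (fun _ => rfl) h r) }

lemma jetToWitt_apply (h : R.Jet P.relation n →ₐ[R.ring n] B) (a : A) :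
    jetToWitt P h a =
      expWitt R n fun i => h ((R.jetSeq P.relation).deriv n (jetZero P a) i) :=
  expComp_apply (C := R.jetSeq P.relation) h _

/-- The coordinates `h (x_γ^(i))` are recovered from the Witt vector attached to `x_γ`. -/
lemma jetToWitt_injective : Function.Injective
    (jetToWitt P : (R.Jet P.relation n →ₐ[R.ring n] B) → (A →ₐ[R.ring 0] R.WittAlg n B)) := by
  intro h h' e
  refine Ideal.Quotient.algHom_ext _ (MvPolynomial.algHom_ext fun s => ?_)
  have := DFunLike.congr_fun e (P.val s.1)
  rw [jetToWitt_apply, jetToWitt_apply] at this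
  have := congrFun (expWitt_bijective.1 this) s.2
  simp only [jetSeq_deriv_val] at this
  exact this

/-- A morphism `A → W_n(B)` comes from `J_n A`: the Witt vectors assigned to the generators `x_γ`
determine values for the `x_γ^(i)`, and the relations `δ ^ i f_j` hold because the Witt vector
assigned to `f_j` is zero. -/
lemma jetToWitt_surjective : Function.Surjective
    (jetToWitt P : (R.Jet P.relation n →ₐ[R.ring n] B) → (A →ₐ[R.ring 0] R.WittAlg n B)) := by
  intro g
  choose v hv using fun γ => expWitt_bijective.2 (g (P.val γ))
  let h₀ : R.PolyRing ι n →ₐ[R.ring n] B := MvPolynomial.aeval fun s => v s.1 s.2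
  have key : (expComp (C := R.polySeq ι) h₀).comp (R.polyZero ι).toRingHom =
      g.toRingHom.comp (MvPolynomial.aeval P.val).toRingHom := by
    refine MvPolynomial.ringHom_ext (fun r => ?_) fun γ => ?_
    · refine (congrArg (expComp (C := R.polySeq ι) h₀) ((R.polyZero ι).commutes r)).trans ?_
      refine (expComp_hom (R.polyIncl ι) (fun _ => rfl) h₀ r).trans ?_
      refine (g.commutes r).symm.trans (congrArg g ?_)
      exact ((MvPolynomial.aeval P.val).commutes r).symm
    · refine (congrArg (expComp (C := R.polySeq ι) h₀) (MvPolynomial.rename_X _ γ)).trans ?_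
      refine (expComp_apply (C := R.polySeq ι) h₀ _).trans ?_
      refine Eq.trans ?_ ((hv γ).trans (congrArg g (MvPolynomial.aeval_X P.val γ).symm))
      refine congrArg _ (funext fun i => ?_)
      rw [polySeq_deriv_X _ _ (Nat.lt_succ_iff.1 i.2)]
      exact MvPolynomial.aeval_X _ _
  have key' (p : MvPolynomial ι (R.ring 0)) :
      (expWitt R n fun i => h₀ ((R.polySeq ι).deriv n (R.polyZero ι p) i)) =
        g (MvPolynomial.aeval P.val p) :=
    (expComp_apply (C := R.polySeq ι) h₀ _).symm.trans (DFunLike.congr_fun key p)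
  have h0 : ∀ x ∈ R.jetIdeal P.relation n, h₀ x = 0 := by
    suffices R.jetIdeal P.relation n ≤ RingHom.ker h₀ from fun a ha => this ha
    refine Ideal.span_le.2 ?_
    rintro _ ⟨j, i, hi, rfl⟩
    have := key' (P.relation j)
    rw [P.aeval_val_relation, map_zero, expWitt_eq_zero_iff] at this
    exact congrFun this ⟨i, Nat.lt_succ_of_le hi⟩
  refine ⟨Ideal.Quotient.liftₐ _ h₀ h0, AlgHom.ext fun a => ?_⟩
  rw [jetToWitt_apply]
  refine Eq.trans ?_ ((key' (P.σ a)).trans (congrArg g (P.aeval_val_σ a)))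
  refine congrArg _ (funext fun i => ?_)
  exact congrArg (Ideal.Quotient.liftₐ _ h₀ h0) (jetSeq_deriv_jetMk P (R.polyZero ι (P.σ a)) i)

/-- The adjunction between the jet algebra and Witt vectors: morphisms of `R_n`-algebras
`J_n A → B` correspond to morphisms of `R_0`-algebras `A → W_n(B)`. -/
noncomputable def jetWittEquiv :
    (R.Jet P.relation n →ₐ[R.ring n] B) ≃ (A →ₐ[R.ring 0] R.WittAlg n B) :=
  Equiv.ofBijective (jetToWitt P) ⟨jetToWitt_injective P, jetToWitt_surjective P⟩

lemma jetWittEquiv_comp {B' : Type u} [CommRing B'] [Algebra (R.ring n) B']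
    (f : B →ₐ[R.ring n] B') (h : R.Jet P.relation n →ₐ[R.ring n] B) :
    jetWittEquiv P (f.comp h) = (R.wittMap f).comp (jetWittEquiv P h) := by
  refine AlgHom.ext fun a => ?_
  refine (jetToWitt_apply P (f.comp h) a).trans ?_
  refine Eq.trans ?_ (congrArg (R.wittMap f) (jetToWitt_apply P h a)).symm
  rw [wittMap_expWitt]
  rfl

variable {A' : Type u} [CommRing A'] [Algebra (R.ring 0) A'] {ι' σ' : Type u}
  (P' : Algebra.Presentation (R.ring 0) A' ι' σ')

/-- `J_n g` commutes with the formation of iterated derivatives of elements of `A`. -/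
lemma jetMap_deriv (g : A →ₐ[R.ring 0] A') (a : A) (i : ℕ) :
    jetMap P P' g n ((R.jetSeq P.relation).deriv n (jetZero P a) i) =
      (R.jetSeq P'.relation).deriv n (jetZero P' (g a)) i := by
  refine (congrArg (jetMap P P' g n)
    (jetSeq_deriv_jetMk P (R.polyZero ι (P.σ a)) i)).trans ?_
  refine (jetEval_eq P P' g n _).trans ((polyEval_deriv _ _ _ _ _).trans ?_)
  rw [← jetEval_eq, jetEval_polyZero, P.aeval_val_σ]

lemma jetWittEquiv_comp_jetMap (g : A →ₐ[R.ring 0] A')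
    (h : R.Jet P'.relation n →ₐ[R.ring n] B) :
    jetWittEquiv P (h.comp (jetMap P P' g n)) = (jetWittEquiv P' h).comp g := by
  refine AlgHom.ext fun a => ?_
  refine (jetToWitt_apply P _ a).trans (Eq.trans ?_ (jetToWitt_apply P' h (g a)).symm)
  refine congrArg _ (funext fun i => ?_)
  exact congrArg h (jetMap_deriv P P' g a i)

end Jet

end ProlongationSequence

end PiJet

namespace PiJet

/-! ### Affine schemes and étale descent -/

open CategoryTheory Opposite AlgebraicGeometry Limits

section Affine

variable {R : CommRingCat.{u}}

/-- The canonical morphism from a scheme over `Spec R` to the spectrum of its ring of functions. -/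
noncomputable def toAlgSpec (X : Over (Spec R)) : X ⟶ (algSpec R).obj ((algΓ R).obj X) :=
  Over.homMk X.left.toSpecΓ (by
    change X.left.toSpecΓ ≫ Spec.map ((Scheme.ΓSpecIso R).inv ≫ X.hom.appTop) = X.hom
    rw [Spec.map_comp, ← Scheme.toSpecΓ_naturality_assoc, toSpecΓ_SpecMap_ΓSpecIso_inv,
      Category.comp_id])

lemma toAlgSpec_naturality {X Y : Over (Spec R)} (f : X ⟶ Y) :
    f ≫ toAlgSpec Y = toAlgSpec X ≫ (algSpec R).map ((algΓ R).map f) := by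
  ext : 1
  exact Scheme.toSpecΓ_naturality f.left

lemma isIso_toAlgSpec (X : Over (Spec R)) [IsAffine X.left] : IsIso (toAlgSpec X) := by
  have : IsIso ((Over.forget _).map (toAlgSpec X)) :=
    inferInstanceAs (IsIso X.left.toSpecΓ)
  exact isIso_of_reflects_iso _ (Over.forget _)

variable {S : Type u} [CommRing S]

/-- Morphisms of `S`-algebras as morphisms of their spectra over `Spec S`. -/
noncomputable def specEquiv (A B : CommAlgCat.{u} S) :
    (A →ₐ[S] B) ≃ ((algSpec (CommRingCat.of S)).obj (op B) ⟶
      (algSpec (CommRingCat.of S)).obj (op A)) :=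
  Equiv.trans
    { toFun g := (CommAlgCat.ofHom g).op
      invFun f := f.unop.hom
      left_inv _ := rfl
      right_inv _ := rfl }
    (algSpec.fullyFaithful (R := CommRingCat.of S)).homEquiv

lemma specEquiv_comp {A B C : CommAlgCat.{u} S} (f : B →ₐ[S] C) (g : A →ₐ[S] B) :
    specEquiv A C (f.comp g) = specEquiv B C f ≫ specEquiv A B g :=
  (algSpec (CommRingCat.of S)).map_comp (CommAlgCat.ofHom f).op (CommAlgCat.ofHom g).op

/-- The points of an affine scheme over `Spec S` with values in an `S`-algebra, as morphisms of
`S`-algebras. -/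
noncomputable def affinePoints (X : Over (Spec (CommRingCat.of S))) [IsAffine X.left]
    (B : CommAlgCat.{u} S) :
    ((algSpec (CommRingCat.of S)).obj (op B) ⟶ X) ≃ (functions X →ₐ[S] B) :=
  have := isIso_toAlgSpec X
  ((asIso (toAlgSpec X)).homToEquiv).trans (specEquiv (functions X) B).symm

lemma specEquiv_affinePoints (X : Over (Spec (CommRingCat.of S))) [IsAffine X.left]
    (B : CommAlgCat.{u} S) (s : (algSpec (CommRingCat.of S)).obj (op B) ⟶ X) :
    specEquiv (functions X) B (affinePoints X B s) = s ≫ toAlgSpec X :=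
  (specEquiv (functions X) B).apply_symm_apply _

lemma affinePoints_comp_left (X : Over (Spec (CommRingCat.of S))) [IsAffine X.left]
    {B C : CommAlgCat.{u} S} (f : B ⟶ C)
    (s : (algSpec (CommRingCat.of S)).obj (op B) ⟶ X) :
    affinePoints X C ((algSpec (CommRingCat.of S)).map f.op ≫ s) =
      f.hom.comp (affinePoints X B s) := by
  apply (specEquiv (functions X) C).injective
  rw [specEquiv_affinePoints, specEquiv_comp, specEquiv_affinePoints, Category.assoc]
  rfl

lemma affinePoints_comp_right {X Y : Over (Spec (CommRingCat.of S))} [IsAffine X.left]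
    [IsAffine Y.left] (f : X ⟶ Y) (B : CommAlgCat.{u} S)
    (s : (algSpec (CommRingCat.of S)).obj (op B) ⟶ X) :
    affinePoints Y B (s ≫ f) = (affinePoints X B s).comp (functionsMap f) := by
  apply (specEquiv (functions Y) B).injective
  rw [specEquiv_affinePoints, specEquiv_comp, specEquiv_affinePoints, Category.assoc,
    Category.assoc, toAlgSpec_naturality]
  rfl

end Affine

section Etale

instance subcanonical_etaleTopology : Scheme.etaleTopology.Subcanonical :=
  .of_le (K := Scheme.proetaleTopology) Scheme.etaleTopology_le_proetaleTopology

variable (R : Type u) [CommRing R]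

lemma isStableUnderBaseChange_precoverage (P : MorphismProperty Scheme.{u})
    [P.IsStableUnderBaseChange] : (Scheme.precoverage P).IsStableUnderBaseChange :=
  inferInstance

lemma isStableUnderBaseChange_etalePrecoverage :
    Scheme.etalePrecoverage.{u}.IsStableUnderBaseChange :=
  isStableUnderBaseChange_precoverage @Etale

/-- The spectrum functor turns sheaves on the big étale site over `Spec R` into sheaves on affine
schemes: it preserves pullbacks and takes the generating coverings of affine schemes to étale
coverings. -/
lemma isContinuous_algSpec :
    (algSpec (CommRingCat.of R)).IsContinuous (affineEtaleTopology R)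
      (Scheme.etaleTopology.over (Spec (CommRingCat.of R))) := by
  have := isStableUnderBaseChange_etalePrecoverage.{u}
  have hover : Scheme.etaleTopology.over (Spec (CommRingCat.of R)) =
      (Scheme.etalePrecoverage.comap (Over.forget (Spec (CommRingCat.of R)))).toGrothendieck :=
    over_toGrothendieck_eq_toGrothendieck_comap_forget Scheme.etalePrecoverage _
  have : PreservesLimitsOfShape WalkingCospan (algSpec (CommRingCat.of R)) :=
    (preservesLimitsOfSize_algSpec.{0, 0} (R := CommRingCat.of R)).preservesLimitsOfShape
  rw [hover]
  unfold affineEtaleTopology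
  rw [Precoverage.comap_comp]
  exact Functor.isContinuous_toGrothendieck_of_pullbacksPreservedBy _ _ _ le_rfl

/-- Schemes are étale sheaves on affine schemes. -/
lemma isSheaf_points (X : Over (Spec (CommRingCat.of R))) :
    Presheaf.IsSheaf (affineEtaleTopology R) ((points R).obj X) := by
  have := isContinuous_algSpec R
  refine Functor.op_comp_isSheaf_of_isSheaf (algSpec (CommRingCat.of R)) _
    (Scheme.etaleTopology.over (Spec (CommRingCat.of R))) (yoneda.obj X) ?_
  rw [isSheaf_iff_isSheaf_of_type]
  exact GrothendieckTopology.Subcanonical.isSheaf_of_isRepresentable _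

end Etale

end PiJet

namespace PiJet

/-! ### Comparison of the two jet spaces -/

namespace ProlongationSequence

open CategoryTheory Opposite AlgebraicGeometry

variable {O : Type v} [CommRing O] {π : O} [Fact (Prime π)] [Finite (O ⧸ Ideal.span {π})]
  [IsDomain O] (R : ProlongationSequence.{v, u} π) (n : ℕ)
  {X Y : Over (Spec (CommRingCat.of (R.ring 0)))} {ι σ ι' σ' : Type u}

/-- The bijection `X(W_n(B)) ≃ Hom_{R_n}(Spec B, Spec (J_n A))`, for `X = Spec A`. -/
noncomputable def jetPointsEquiv [IsAffine X.left]
    (P : Algebra.Presentation (R.ring 0) (functions X) ι σ) (B : CommAlgCat.{u} (R.ring n)) :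
    ((algSpec (CommRingCat.of (R.ring 0))).obj (op ((R.wittFunctor n).obj B)) ⟶ X) ≃
      ((algSpec (CommRingCat.of (R.ring n))).obj (op B) ⟶ R.buiumJet n P) :=
  ((affinePoints X ((R.wittFunctor n).obj B)).trans (jetWittEquiv P).symm).trans
    (specEquiv (CommAlgCat.of (R.ring n) (R.Jet P.relation n)) B)

lemma jetPointsEquiv_apply [IsAffine X.left]
    (P : Algebra.Presentation (R.ring 0) (functions X) ι σ) (B : CommAlgCat.{u} (R.ring n))
    (s : (algSpec (CommRingCat.of (R.ring 0))).obj (op ((R.wittFunctor n).obj B)) ⟶ X) :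
    R.jetPointsEquiv n P B s = specEquiv (CommAlgCat.of (R.ring n) (R.Jet P.relation n)) B
      ((jetWittEquiv P).symm (affinePoints X ((R.wittFunctor n).obj B) s)) := rfl

/-- Naturality in the `R_n`-algebra `B`. -/
lemma jetPointsEquiv_comp_left [IsAffine X.left]
    (P : Algebra.Presentation (R.ring 0) (functions X) ι σ) {B C : CommAlgCat.{u} (R.ring n)}
    (f : B ⟶ C)
    (s : (algSpec (CommRingCat.of (R.ring 0))).obj (op ((R.wittFunctor n).obj B)) ⟶ X) :
    R.jetPointsEquiv n P C
        ((algSpec (CommRingCat.of (R.ring 0))).map ((R.wittFunctor n).map f).op ≫ s) =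
      (algSpec (CommRingCat.of (R.ring n))).map f.op ≫ R.jetPointsEquiv n P B s := by
  rw [jetPointsEquiv_apply, jetPointsEquiv_apply]
  refine Eq.trans ?_ (specEquiv_comp f.hom _)
  refine congrArg _ ((jetWittEquiv P).symm_apply_eq.2 ?_)
  refine (affinePoints_comp_left X ((R.wittFunctor n).map f) s).trans ?_
  exact ((jetWittEquiv_comp P f.hom _).trans
    (congrArg (R.wittMap f.hom).comp ((jetWittEquiv P).apply_symm_apply _))).symm

/-- Naturality in the affine scheme `X`, for arbitrary presentations. -/
lemma jetPointsEquiv_comp_right [IsAffine X.left] [IsAffine Y.left] (f : X ⟶ Y)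
    (P : Algebra.Presentation (R.ring 0) (functions X) ι σ)
    (Q : Algebra.Presentation (R.ring 0) (functions Y) ι' σ') (B : CommAlgCat.{u} (R.ring n))
    (s : (algSpec (CommRingCat.of (R.ring 0))).obj (op ((R.wittFunctor n).obj B)) ⟶ X) :
    R.jetPointsEquiv n Q B (s ≫ f) = R.jetPointsEquiv n P B s ≫ R.buiumJetMap n f P Q := by
  rw [jetPointsEquiv_apply, jetPointsEquiv_apply, affinePoints_comp_right]
  refine Eq.trans ?_ (specEquiv_comp
    (A := CommAlgCat.of (R.ring n) (R.Jet Q.relation n))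
    (B := CommAlgCat.of (R.ring n) (R.Jet P.relation n)) _ (jetMap Q P (functionsMap f) n))
  refine congrArg _ ((jetWittEquiv Q).symm_apply_eq.2 ?_)
  exact ((jetWittEquiv_comp_jetMap Q P (functionsMap f) _).trans
    (congrArg (fun g => AlgHom.comp g (functionsMap f))
      ((jetWittEquiv P).apply_symm_apply _))).symm

/-- The isomorphism `J^n X ≅ J^n_Bu X` for an affine scheme `X = Spec A` over `R_0`. -/
noncomputable def borgerIsoBuium [IsAffine X.left]
    (P : Algebra.Presentation (R.ring 0) (functions X) ι σ) :
    (R.borgerJet n).obj ((points (R.ring 0)).obj X) ≅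
      (points (R.ring n)).obj (R.buiumJet n P) :=
  NatIso.ofComponents (fun B => (R.jetPointsEquiv n P B.unop.unop).toIso) fun {B C} f => by
    ext s
    exact R.jetPointsEquiv_comp_left n P f.unop.unop s

end ProlongationSequence

end PiJet

open PiJet CategoryTheory AlgebraicGeometry
theorem corollary3p1 {O : Type v} [CommRing O] [IsDedekindDomain O] (π : O) [Fact (Prime π)]
    [Finite (O ⧸ Ideal.span {π})] (R : ProlongationSequence.{v, u} π) (n : ℕ) :
    (∃ e : ∀ (X : Over (Spec (CommRingCat.of (R.ring 0)))) (_ : IsAffine X.left) (ι σ : Type u)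
        (P : Algebra.Presentation (R.ring 0) (functions X) ι σ),
        (R.borgerJet n).obj ((points (R.ring 0)).obj X) ≅
          (points (R.ring n)).obj (R.buiumJet n P),
      ∀ (X Y : Over (Spec (CommRingCat.of (R.ring 0)))) (hX : IsAffine X.left)
        (hY : IsAffine Y.left) (f : X ⟶ Y) (ι σ ι' σ' : Type u)
        (P : Algebra.Presentation (R.ring 0) (functions X) ι σ)
        (Q : Algebra.Presentation (R.ring 0) (functions Y) ι' σ'),
        (R.borgerJet n).map ((points (R.ring 0)).map f) ≫ (e Y hY ι' σ' Q).hom =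
          (e X hX ι σ P).hom ≫ (points (R.ring n)).map (R.buiumJetMap n f P Q)) ∧
    ∀ X : Over (Spec (CommRingCat.of (R.ring 0))), IsAffine X.left →
      Presheaf.IsSheaf (affineEtaleTopology (R.ring n))
        ((R.borgerJet n).obj ((points (R.ring 0)).obj X)) ∧
      ∃ Y : Over (Spec (CommRingCat.of (R.ring n))), IsAffine Y.left ∧
        Nonempty ((R.borgerJet n).obj ((points (R.ring 0)).obj X) ≅ (points (R.ring n)).obj Y) := by
  refine ⟨⟨fun X hX ι σ P => R.borgerIsoBuium n P, ?_⟩, fun X hX => ?_⟩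
  · intro X Y hX hY f ι σ ι' σ' P Q
    ext B s
    exact R.jetPointsEquiv_comp_right n f P Q B.unop.unop s
  -- The tautological presentation: all elements as generators, the whole kernel as relations.
  · let P : Algebra.Presentation (R.ring 0) (functions X) (functions X)
        (Algebra.Generators.self (R.ring 0) (functions X)).ker :=
      { Algebra.Generators.self (R.ring 0) (functions X) with
        relation := Subtype.val
        span_range_relation_eq_ker := by
          rw [Subtype.range_coe_subtype]
          exact Ideal.span_eq (Algebra.Generators.self (R.ring 0) (functions X)).ker }
    refine ⟨?_, R.buiumJet n P, ?_, ⟨R.borgerIsoBuium n P⟩⟩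
    · exact (Presheaf.isSheaf_of_iso_iff (R.borgerIsoBuium n P)).2 (isSheaf_points _ _)
    · exact inferInstanceAs (IsAffine (Spec _))
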